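/- Terminology on the unit sphere $S^2\subset E^3$, with spherical distance $|xy|$. The arc connecting two non-antipodal points is the shorter great-circle arc between them. A convex body is a closed subset with non-empty interior that contains no pair of antipodes and contains, with every two points, the arc connecting them. A hemisphere $H(m)$ is the set of points at distance at most $\pi/2$ from its center $m$; it supports a convex body $C$ at a boundary point $p$ of $C$ if $C\subset H(m)$ and $p$ lies on the great circle $\mathrm{bd}(H(m))$; it supports $C$ if it does so at some $p$. For hemispheres $G,H$ that are different and not opposite, $G\cap H$ is a lune; it is bounded by the semicircles $G/H=\mathrm{bd}(G)\cap H$ and $H/G=\mathrm{bd}(H)\cap G$, and its thickness is the distance of their centers. For a hemisphere $K$ supporting $C$, $K^*$ denotes a hemisphere supporting $C$ such that $K\cap K^*$ is a lune of minimum thickness; that thickness is $\mathrm{width}_K(C)$. The thickness $\Delta(C)$ is the minimum of $\mathrm{width}_K(C)$ over all hemispheres $K$ supporting $C$. A convex body $R$ is reduced if $\Delta(Z)<\Delta(R)$ for every convex body $Z\subset R$ different from $R$. For different hemispheres $X,Y,Z$ supporting $C$, with centers $x,y,z$, write $\prec XYZ$ if either the three great circles bounding $X,Y,Z$ have no common point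 and $x,y,z$ are in this order on the boundary of the spherical triangle $xyz$ according to the positive orientation, or these great circles have a common point $c\in C$ and $x,y,z$ are in this (cyclic) order on the boundary of the hemisphere centered at $c$ according to the positive orientation. Write $\preceq XYZ$ if $\prec XYZ$ or $X=Y$ or $Y=Z$ or $Z=X$. **Proposition.** Let $R\subset S^2$ be a reduced convex body with $\Delta(R)<\frac{\pi}{2}$. Let $M_1\neq M_2$ be two hemispheres supporting $R$ with $\mathrm{width}_{M_1}(R)=\Delta(R)=\mathrm{width}_{M_2}(R)$. Denote by $a_i$ the center of the semicircle $M_i/M_i^*$ and by $b_i$ the center of the semicircle $M_i^*/M_i$, for $i=1,2$. Assume that $a_1=a_2$ and that $\preceq M_1MM_2$ for every hemisphere $M$ supporting $R$ at this point. Then the shorter piece, connecting $b_1$ and $b_2$, of the spherical circle with center $a_1=a_2$ and radius $\Delta(R)$ is contained in the boundary of $R$. Moreover, $\mathrm{width}_M(R)=\Delta(R)$ for every hemisphere $M$ supporting $R$ at the point $a_1=a_2$. -/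

import Mathlib

open scoped Real

namespace SphericalReduced

/-- The unit sphere of the three-dimensional Euclidean space, with its subspace topology. -/
abbrev S2 : Type := Metric.sphere (0 : EuclideanSpace ℝ (Fin 3)) 1

/-- Spherical distance: the length of the shorter great-circle arc between two points. -/
noncomputable def sdist (x y : S2) : ℝ :=
  InnerProductGeometry.angle (x : EuclideanSpace ℝ (Fin 3)) (y : EuclideanSpace ℝ (Fin 3))

/-- The spherical arc connecting two points that are not antipodes: the points of the sphere in
the convex cone spanned by them. -/
def arc (a b : S2) : Set S2 :=
  {x | ∃ s t : ℝ, 0 ≤ s ∧ 0 ≤ t ∧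
    (x : EuclideanSpace ℝ (Fin 3)) = s • (a : EuclideanSpace ℝ (Fin 3)) + t • (b : EuclideanSpace ℝ (Fin 3))}

/-- Spherical convexity: no pair of antipodes, and with every two points the arc between them. -/
def IsSphConvex (C : Set S2) : Prop :=
  (∀ x ∈ C, -x ∉ C) ∧ ∀ x ∈ C, ∀ y ∈ C, arc x y ⊆ C

/-- Spherical convex body: a closed convex set with non-empty interior. -/
structure IsConvexBody (C : Set S2) : Prop where
  closed : IsClosed C
  convex : IsSphConvex C
  interior_nonempty : (interior C).Nonempty

/-- The hemisphere with center `m`. A hemisphere determines its center, so that hemispheres are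
represented by their centers below. -/
def hemisphere (m : S2) : Set S2 := {x | sdist m x ≤ π / 2}

/-- The great circle bounding the hemisphere with center `m`. -/
def greatCircle (m : S2) : Set S2 := {x | sdist m x = π / 2}

/-- The hemisphere with center `m` supports `C` at the boundary point `p` of `C`. -/
def SupportsAt (m : S2) (C : Set S2) (p : S2) : Prop :=
  p ∈ frontier C ∧ C ⊆ hemisphere m ∧ p ∈ greatCircle m

/-- The hemisphere with center `m` supports `C`. -/
def Supports (m : S2) (C : Set S2) : Prop := ∃ p, SupportsAt m C p

/-- The hemispheres with centers `g` and `h` are different and not opposite, so that their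
intersection is a lune. -/
def IsLune (g h : S2) : Prop := g ≠ h ∧ g ≠ -h

/-- The semicircle `G/H` bounding the lune `G ∩ H`, for `G`, `H` with centers `g`, `h`: the one of
the two bounding semicircles that lies on the great circle bounding `G`. -/
def semicircle (g h : S2) : Set S2 := greatCircle g ∩ hemisphere h

/-- `a` is the center of the semicircle `G/H`: it lies on the great circle bounding `G`, and `G/H`
consists of the points of this great circle in the distance at most `π / 2` from `a`. -/
def IsSemicircleCenter (g h a : S2) : Prop :=
  a ∈ greatCircle g ∧ semicircle g h = {x | x ∈ greatCircle g ∧ sdist a x ≤ π / 2}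

/-- `t` is the thickness of the lune `G ∩ H`: the distance of the centers of `G/H` and `H/G`. -/
def IsLuneThickness (g h : S2) (t : ℝ) : Prop :=
  IsLune g h ∧ ∃ a b : S2, IsSemicircleCenter g h a ∧ IsSemicircleCenter h g b ∧ t = sdist a b

/-- `width_K (C)`, for `K` with center `k`: the minimum thickness of a lune `K ∩ K'`, where `K'`
is a hemisphere supporting `C`. -/
noncomputable def width (C : Set S2) (k : S2) : ℝ :=
  sInf {t : ℝ | ∃ h : S2, Supports h C ∧ IsLuneThickness k h t}

/-- The hemisphere with center `k'` is a hemisphere `K^*`, for `K` with center `k`: it supports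
`C`, and the lune `K ∩ K^*` has the minimum thickness among the lunes `K ∩ K'` with `K'`
supporting `C`. -/
def IsStar (C : Set S2) (k k' : S2) : Prop :=
  Supports k' C ∧ ∃ t : ℝ, IsLuneThickness k k' t ∧
    ∀ (h : S2) (u : ℝ), Supports h C → IsLuneThickness k h u → t ≤ u

/-- The thickness `Δ(C)`: the minimum width of `C` over all supporting hemispheres. -/
noncomputable def thickness (C : Set S2) : ℝ :=
  sInf {w : ℝ | ∃ k : S2, Supports k C ∧ w = width C k}

/-- Reduced convex body: every different convex body contained in it has smaller thickness. -/
def IsReduced (R : Set S2) : Prop :=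
  IsConvexBody R ∧ ∀ Z : Set S2, IsConvexBody Z → Z ⊆ R → Z ≠ R → thickness Z < thickness R

/-- The vector into which `x`, orthogonal to `c`, is moved by the rotation about the axis `c`
through the angle `s`, counterclockwise as seen from outside the sphere at `c`. -/
noncomputable def rotate (c x : S2) (s : ℝ) : EuclideanSpace ℝ (Fin 3) :=
  Real.cos s • (x : EuclideanSpace ℝ (Fin 3)) +
    Real.sin s • WithLp.toLp 2 (crossProduct (WithLp.ofLp (c : EuclideanSpace ℝ (Fin 3)))
      (WithLp.ofLp (x : EuclideanSpace ℝ (Fin 3))))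

/-- The relation `≺ XYZ` for hemispheres with centers `x`, `y`, `z` supporting `C`.
If the three bounding great circles have no common point, then `x`, `y`, `z` are in the positive
order on the boundary of the spherical triangle `xyz`. If they have a common point `c`
(the one of the two antipodal common points at which `C` is supported), then `x`, `y`, `z` are in
the positive cyclic order on the boundary of the hemisphere centered at `c`. -/
def Prec (C : Set S2) (x y z : S2) : Prop :=
  (greatCircle x ∩ greatCircle y ∩ greatCircle z = ∅ ∧
    0 < Matrix.det (Matrix.of ![WithLp.ofLp (x : EuclideanSpace ℝ (Fin 3)),
      WithLp.ofLp (y : EuclideanSpace ℝ (Fin 3)), WithLp.ofLp (z : EuclideanSpace ℝ (Fin 3))])) ∨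
  ∃ c ∈ greatCircle x ∩ greatCircle y ∩ greatCircle z, c ∈ C ∧
    ∃ s t : ℝ, 0 < s ∧ s < t ∧ t < 2 * π ∧
      (y : EuclideanSpace ℝ (Fin 3)) = rotate c x s ∧
      (z : EuclideanSpace ℝ (Fin 3)) = rotate c x t

/-- The relation `⪯ XYZ`: the hemisphere `Y` supports `C` between `X` and `Z`. -/
def Preceq (C : Set S2) (x y z : S2) : Prop :=
  Prec C x y z ∨ x = y ∨ y = z ∨ z = x

/-- The shorter piece, connecting `b` and `b'`, of the spherical circle with center `a` and
radius `ρ`: the points of the circle in the directions, seen from `a`, that lie in the convex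
angle between the directions of `b` and `b'`. -/
def circlePiece (a : S2) (ρ : ℝ) (b b' : S2) : Set S2 :=
  {x | sdist a x = ρ ∧ ∃ r s t : ℝ, 0 ≤ s ∧ 0 ≤ t ∧
    (x : EuclideanSpace ℝ (Fin 3)) = r • (a : EuclideanSpace ℝ (Fin 3)) +
      s • (b : EuclideanSpace ℝ (Fin 3)) + t • (b' : EuclideanSpace ℝ (Fin 3))}

end SphericalReduced

namespace SphericalReduced

-- The thickness of a lune is π minus the distance of the centers of its two hemispheres. Widths are
-- therefore read off from `polar R`: here Δ = Δ(R) is π minus the diameter of `polar R`. For a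
-- farthest pair in a polar set, the first-order condition `center_mem` puts the centers of both
-- bounding semicircles into the body.
--
-- Write a for a₁ = a₂, let m be a unit vector in the cone spanned by m₁ and m₂, and put h = sin Δ ·
-- a − cos Δ · m. The lune H(m) ∩ H(h) has thickness Δ, and its semicircles have centers a and cos Δ
-- · a + sin Δ · m. The latter point traces the circle piece as m varies. If R ⊆ H(h), this lune is
-- a thinnest one around R, and both claims follow (`frontier_and_width_of_mem_polar`).
--
-- The inclusion R ⊆ H(h) is `mem_polar_of_isReduced`. If it fails, Z = R ∩ H(h) is a smaller convex
-- body, hence thinner, so a farthest pair k, k' of `polar Z` has inner product below −cos Δ. The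
-- points k, k' cannot both belong to `polar R`; say k' does not. The center p of the semicircle
-- K'/K then lies on the great circle bounding H(h), which is tangent to the circle of radius Δ
-- about a, so ⟨a, p⟩ ≤ cos Δ. In the gnomonic projection from a, the normal of K' lies between m₁
-- and m₂ (`exists_nonneg_coordinates`). This forces −⟨k, k'⟩ ≤ ⟨a, p⟩
-- (`neg_inner_le_inner_of_centers`), a contradiction.
--
-- The relation ⪯ enters only through `exists_combination_of_preceq`.

local notation "⟪" x ", " y "⟫" =>
  inner ℝ (x : EuclideanSpace ℝ (Fin 3)) (y : EuclideanSpace ℝ (Fin 3))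

/-! ### Distances and hemispheres in terms of inner products -/

lemma norm_coe (x : S2) : ‖(x : EuclideanSpace ℝ (Fin 3))‖ = 1 := norm_eq_of_mem_sphere x

lemma inner_self_coe (x : S2) : ⟪x, x⟫ = 1 := by
  rw [real_inner_self_eq_norm_sq, norm_coe]; norm_num

lemma neg_one_le_inner (x y : S2) : -1 ≤ ⟪x, y⟫ := by
  have := neg_one_le_real_inner_of_norm_eq_one (norm_coe x) (norm_coe y); exact this

lemma inner_le_one (x y : S2) : ⟪x, y⟫ ≤ 1 := by
  have := real_inner_le_one_of_norm_eq_one (norm_coe x) (norm_coe y); exact this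

lemma inner_eq_one_iff (x y : S2) : ⟪x, y⟫ = 1 ↔ x = y := by
  rw [inner_eq_one_iff_of_norm_eq_one (norm_coe x) (norm_coe y), Subtype.ext_iff]

lemma inner_eq_neg_one_iff (x y : S2) : ⟪x, y⟫ = -1 ↔ x = -y := by
  rw [inner_eq_neg_one_iff_of_norm_eq_one (norm_coe x) (norm_coe y), Subtype.ext_iff,
    coe_neg_sphere]

lemma sdist_eq_arccos (x y : S2) : sdist x y = Real.arccos ⟪x, y⟫ := by
  simp [sdist, InnerProductGeometry.angle]

lemma cos_sdist (x y : S2) : Real.cos (sdist x y) = ⟪x, y⟫ := by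
  rw [sdist_eq_arccos, Real.cos_arccos (neg_one_le_inner x y) (inner_le_one x y)]

lemma sdist_le_pi_div_two {x y : S2} : sdist x y ≤ π / 2 ↔ 0 ≤ ⟪x, y⟫ := by
  rw [sdist_eq_arccos, Real.arccos_le_pi_div_two]

lemma mem_hemisphere {m x : S2} : x ∈ hemisphere m ↔ 0 ≤ ⟪m, x⟫ := sdist_le_pi_div_two

lemma mem_greatCircle {m x : S2} : x ∈ greatCircle m ↔ ⟪m, x⟫ = 0 := by
  change sdist m x = π / 2 ↔ _
  rw [sdist_eq_arccos, Real.arccos_eq_pi_div_two]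

/-- Every nonzero vector is a positive multiple of a point of the sphere. -/
lemma exists_sphere_smul {v : EuclideanSpace ℝ (Fin 3)} (hv : v ≠ 0) :
    ∃ x : S2, v = ‖v‖ • (x : EuclideanSpace ℝ (Fin 3)) := by
  have h : ‖v‖ ≠ 0 := norm_ne_zero_iff.2 hv
  refine ⟨⟨‖v‖⁻¹ • v, ?_⟩, ?_⟩
  · simp [norm_smul, h]
  · simp [smul_smul, h]

/-! ### The polar set, the cone over a body, and separation -/

/-- The centers of the hemispheres containing `C`. -/
def polar (C : Set S2) : Set S2 := {m | ∀ x ∈ C, 0 ≤ ⟪m, x⟫}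

lemma subset_hemisphere_iff {C : Set S2} {m : S2} : C ⊆ hemisphere m ↔ m ∈ polar C :=
  ⟨fun h _ hx => mem_hemisphere.1 (h hx), fun h x hx => mem_hemisphere.2 (h x hx)⟩

lemma isClosed_polar (C : Set S2) : IsClosed (polar C) := by
  have : polar C = ⋂ x ∈ C, {m : S2 | 0 ≤ inner ℝ (m : EuclideanSpace ℝ (Fin 3)) x} := by
    ext m; simp [polar]
  rw [this]
  refine isClosed_biInter fun x _ => isClosed_le continuous_const ?_
  fun_prop

/-- The cone over a nonempty subset of the sphere. -/
def coneOver (C : Set S2) : Set (EuclideanSpace ℝ (Fin 3)) :=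
  {v | ∃ x ∈ C, v = ‖v‖ • (x : EuclideanSpace ℝ (Fin 3))}

lemma smul_mem_coneOver {C : Set S2} {x : S2} (hx : x ∈ C) {t : ℝ} (ht : 0 ≤ t) :
    t • (x : EuclideanSpace ℝ (Fin 3)) ∈ coneOver C :=
  ⟨x, hx, by rw [norm_smul, norm_coe, mul_one, Real.norm_of_nonneg ht]⟩

lemma coe_mem_coneOver {C : Set S2} {x : S2} (hx : x ∈ C) :
    (x : EuclideanSpace ℝ (Fin 3)) ∈ coneOver C := by
  simpa using smul_mem_coneOver hx zero_le_one

lemma mem_of_smul_mem_coneOver {C : Set S2} {x : S2} {t : ℝ} (ht : 0 < t)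
    (h : t • (x : EuclideanSpace ℝ (Fin 3)) ∈ coneOver C) : x ∈ C := by
  obtain ⟨y, hy, e⟩ := h
  rw [norm_smul, norm_coe, mul_one, Real.norm_of_nonneg ht.le] at e
  have : (x : EuclideanSpace ℝ (Fin 3)) = y := smul_right_injective _ ht.ne' e
  rwa [Subtype.ext this]

lemma inner_nonneg_of_mem_coneOver {C : Set S2} {m : S2} (hm : m ∈ polar C)
    {v : EuclideanSpace ℝ (Fin 3)} (hv : v ∈ coneOver C) : 0 ≤ ⟪m, v⟫ := by
  obtain ⟨x, hx, e⟩ := hv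
  rw [e, real_inner_smul_right]
  exact mul_nonneg (norm_nonneg _) (hm x hx)

/-- The cone is the projection of a closed set of pairs (vector, direction) along the compact sphere
of directions. -/
lemma isClosed_coneOver {C : Set S2} (hC : IsClosed C) : IsClosed (coneOver C) := by
  have h : IsClosed {q : EuclideanSpace ℝ (Fin 3) × S2 |
      q.2 ∈ C ∧ q.1 = ‖q.1‖ • (q.2 : EuclideanSpace ℝ (Fin 3))} :=
    (hC.preimage continuous_snd).inter (isClosed_eq (by fun_prop) (by fun_prop))
  have := isClosedMap_fst_of_compactSpace (X := EuclideanSpace ℝ (Fin 3)) (Y := S2) _ h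
  convert this using 1
  ext v
  simp [coneOver]

lemma add_mem_coneOver {C : Set S2} (hC : IsSphConvex C) {v w : EuclideanSpace ℝ (Fin 3)}
    (hv : v ∈ coneOver C) (hw : w ∈ coneOver C) : v + w ∈ coneOver C := by
  obtain ⟨x, hx, ex⟩ := hv
  obtain ⟨y, hy, ey⟩ := hw
  by_cases h : v + w = 0
  · exact ⟨x, hx, by simp [h]⟩
  obtain ⟨z, ez⟩ := exists_sphere_smul h
  refine ⟨z, hC.2 x hx y hy ⟨‖v + w‖⁻¹ * ‖v‖, ‖v + w‖⁻¹ * ‖w‖, by positivity, by positivity, ?_⟩, ez⟩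
  rw [mul_smul, mul_smul, ← ex, ← ey, ← smul_add]
  nth_rw 2 [ez]
  rw [smul_smul, inv_mul_cancel₀ (norm_ne_zero_iff.2 h), one_smul]

lemma smul_mem_coneOver_of_mem {C : Set S2} {v : EuclideanSpace ℝ (Fin 3)}
    (hv : v ∈ coneOver C) {t : ℝ} (ht : 0 ≤ t) : t • v ∈ coneOver C := by
  obtain ⟨x, hx, ex⟩ := hv
  rw [ex, smul_smul]
  exact smul_mem_coneOver hx (by positivity)

lemma convex_coneOver {C : Set S2} (hC : IsSphConvex C) : Convex ℝ (coneOver C) :=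
  fun _ hv _ hw _ _ ha hb _ =>
    add_mem_coneOver hC (smul_mem_coneOver_of_mem hv ha) (smul_mem_coneOver_of_mem hw hb)

/-- A point outside a closed convex set is cut off from it by a plane through the origin. -/
lemma exists_separating {C : Set S2} (hne : C.Nonempty) (hcl : IsClosed C) (hC : IsSphConvex C)
    {p : S2} (hp : p ∉ C) :
    ∃ y : EuclideanSpace ℝ (Fin 3), (∀ x ∈ C, 0 ≤ ⟪y, x⟫) ∧ ⟪y, p⟫ < 0 := by
  obtain ⟨x₀, hx₀⟩ := hne
  let K : ProperCone ℝ (EuclideanSpace ℝ (Fin 3)) :=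
    { carrier := coneOver C
      add_mem' := fun hv hw => add_mem_coneOver hC hv hw
      zero_mem' := by simpa using smul_mem_coneOver hx₀ le_rfl
      smul_mem' := fun c v hv => smul_mem_coneOver_of_mem hv c.2
      isClosed' := isClosed_coneOver hcl }
  have hK : (p : EuclideanSpace ℝ (Fin 3)) ∉ K := fun h =>
    hp (mem_of_smul_mem_coneOver zero_lt_one (by rw [one_smul]; exact h))
  obtain ⟨y, hy, hyp⟩ := ProperCone.hyperplane_separation' K hK
  refine ⟨y, fun x hx => ?_, ?_⟩
  · rw [real_inner_comm]; exact hy x (coe_mem_coneOver hx)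
  · rw [real_inner_comm]; exact hyp

lemma coe_mem_interior_coneOver {C : Set S2} {x : S2} (hx : x ∈ interior C) :
    (x : EuclideanSpace ℝ (Fin 3)) ∈ interior (coneOver C) := by
  obtain ⟨V, hV, hVC⟩ := isOpen_induced_iff.1 (isOpen_interior (s := C))
  rw [mem_interior]
  refine ⟨{v | v ≠ 0} ∩ (fun v => ‖v‖⁻¹ • v) ⁻¹' V, ?_, ?_, ?_⟩
  · rintro v ⟨hv, hvV⟩
    obtain ⟨z, hz⟩ := exists_sphere_smul hv
    refine ⟨z, interior_subset (s := C) ?_, hz⟩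
    rw [← hVC]
    change (z : EuclideanSpace ℝ (Fin 3)) ∈ V
    rw [(eq_inv_smul_iff₀ (norm_ne_zero_iff.2 hv)).2 hz.symm]
    exact hvV
  · refine ContinuousOn.isOpen_inter_preimage ?_ isOpen_ne hV
    intro v hv
    exact ((continuous_norm.continuousAt.inv₀ (norm_ne_zero_iff.2 hv)).smul
      continuousAt_id).continuousWithinAt
  · refine ⟨?_, ?_⟩
    · intro h; have := norm_coe x; simp [h] at this
    · have : x ∈ Subtype.val ⁻¹' V := by rw [hVC]; exact hx
      simpa [norm_coe] using this

lemma inner_pos_of_mem_interior {C : Set S2} {m : S2} (hm : m ∈ polar C)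
    {v : EuclideanSpace ℝ (Fin 3)} (hv : v ∈ interior (coneOver C)) : 0 < ⟪m, v⟫ := by
  -- An interior vector v stays in the cone when pushed slightly against m, which costs ε in the
  -- inner product with m.
  have hcont : Filter.Tendsto (fun ε : ℝ => v - ε • (m : EuclideanSpace ℝ (Fin 3)))
      (nhdsWithin 0 (Set.Ioi 0)) (nhds v) := by
    have : Continuous (fun ε : ℝ => v - ε • (m : EuclideanSpace ℝ (Fin 3))) := by fun_prop
    simpa using (this.tendsto 0).mono_left nhdsWithin_le_nhds
  have h1 := hcont.eventually (mem_interior_iff_mem_nhds.1 hv)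
  obtain ⟨ε, h2, h3⟩ := (h1.and self_mem_nhdsWithin).exists
  have h4 := inner_nonneg_of_mem_coneOver hm h2
  rw [inner_sub_right, real_inner_smul_right, inner_self_coe] at h4
  have h3' : (0 : ℝ) < ε := h3
  linarith

lemma mem_frontier_of_inner_eq_zero {C : Set S2} {m x : S2} (hm : m ∈ polar C) (hx : x ∈ C)
    (h : ⟪m, x⟫ = 0) : x ∈ frontier C :=
  ⟨subset_closure hx, fun hi =>
    (inner_pos_of_mem_interior hm (coe_mem_interior_coneOver hi)).ne' h⟩

/-- Guarantees that two different hemispheres containing a convex body always form a lune. -/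
lemma neg_notMem_polar {C : Set S2} (hC : (interior C).Nonempty) {m : S2} (hm : m ∈ polar C) :
    -m ∉ polar C := by
  intro h
  obtain ⟨x, hx⟩ := hC
  have h1 := inner_pos_of_mem_interior hm (coe_mem_interior_coneOver hx)
  have h2 := inner_pos_of_mem_interior h (coe_mem_interior_coneOver hx)
  rw [coe_neg_sphere, inner_neg_left] at h2
  linarith

lemma supportsAt_iff {C : Set S2} (hC : IsClosed C) {m p : S2} :
    SupportsAt m C p ↔ m ∈ polar C ∧ p ∈ C ∧ ⟪m, p⟫ = 0 := by
  constructor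
  · rintro ⟨h1, h2, h3⟩
    exact ⟨subset_hemisphere_iff.1 h2, hC.frontier_subset h1, mem_greatCircle.1 h3⟩
  · rintro ⟨h1, h2, h3⟩
    exact ⟨mem_frontier_of_inner_eq_zero h1 h2 h3, subset_hemisphere_iff.2 h1,
      mem_greatCircle.2 h3⟩

/-! ### Lunes and the first-order condition at a farthest polar point -/

lemma inner_lt_one_of_ne {x y : S2} (h : x ≠ y) : ⟪x, y⟫ < 1 :=
  lt_of_le_of_ne (inner_le_one x y) fun e => h ((inner_eq_one_iff x y).1 e)

lemma neg_one_lt_inner_of_ne {x y : S2} (h : x ≠ -y) : -1 < ⟪x, y⟫ :=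
  lt_of_le_of_ne (neg_one_le_inner x y) fun e => h ((inner_eq_neg_one_iff x y).1 e.symm)

lemma IsLune.one_sub_sq_pos {g h : S2} (hl : IsLune g h) : 0 < 1 - ⟪g, h⟫ ^ 2 := by
  have h1 := inner_lt_one_of_ne hl.1
  have h2 := neg_one_lt_inner_of_ne hl.2
  nlinarith

lemma IsLune.symm {g h : S2} (hl : IsLune g h) : IsLune h g :=
  ⟨hl.1.symm, fun e => hl.2 (by rw [e, neg_neg])⟩

/-- The first-order condition at a point of the polar set of a convex body that is farthest
from `k`: the center of the corresponding bounding semicircle belongs to the body. -/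
lemma center_mem {C : Set S2} (hne : C.Nonempty) (hcl : IsClosed C) (hC : IsSphConvex C)
    {k k' p : S2} (hk' : k' ∈ polar C) (hmin : ∀ l ∈ polar C, ⟪k, k'⟫ ≤ ⟪k, l⟫)
    {σ : ℝ} (hσ : 0 < σ)
    (hp : σ • (p : EuclideanSpace ℝ (Fin 3)) = (k : EuclideanSpace ℝ (Fin 3)) - ⟪k, k'⟫ • (k' : EuclideanSpace ℝ (Fin 3))) :
    p ∈ C := by
  by_contra hpC
  obtain ⟨y, hy, hyp⟩ := exists_separating hne hcl hC hpC
  set c := ⟪k, k'⟫ with hc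
  have hd : ⟪k, y⟫ - c * ⟪k', y⟫ < 0 := by
    have h1 : σ * ⟪y, p⟫ = ⟪k, y⟫ - c * ⟪k', y⟫ := by
      rw [← real_inner_smul_right, hp, inner_sub_right, real_inner_smul_right,
        real_inner_comm, real_inner_comm y (k' : EuclideanSpace ℝ (Fin 3))]
    rw [← h1]
    exact mul_neg_of_pos_of_neg hσ hyp
  -- Moving k' towards y and normalizing stays inside `polar C`, so it cannot decrease the inner
  -- product with k; by `hd` it would do so to first order.
  have key : ∀ ε : ℝ, 0 < ε → c * ‖(k' : EuclideanSpace ℝ (Fin 3)) + ε • y‖ ≤ c + ε * ⟪k, y⟫ := by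
    intro ε hε
    have e : c + ε * ⟪k, y⟫ = ⟪k, ((k' : EuclideanSpace ℝ (Fin 3)) + ε • y)⟫ := by
      rw [inner_add_right, real_inner_smul_right]
    rw [e]
    by_cases hv : (k' : EuclideanSpace ℝ (Fin 3)) + ε • y = 0
    · simp [hv]
    obtain ⟨l, hl⟩ := exists_sphere_smul hv
    have hn : 0 < ‖(k' : EuclideanSpace ℝ (Fin 3)) + ε • y‖ := norm_pos_iff.2 hv
    have hlC : l ∈ polar C := by
      intro x hx
      have h1 : 0 ≤ ⟪((k' : EuclideanSpace ℝ (Fin 3)) + ε • y), x⟫ := by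
        rw [inner_add_left, real_inner_smul_left]
        exact add_nonneg (hk' x hx) (mul_nonneg hε.le (hy x hx))
      rw [hl, real_inner_smul_left] at h1
      exact nonneg_of_mul_nonneg_right h1 hn
    rw [hl, real_inner_smul_right, ← hl, mul_comm]
    exact mul_le_mul_of_nonneg_left (hmin l hlC) hn.le
  have hsq : ∀ ε : ℝ, ‖(k' : EuclideanSpace ℝ (Fin 3)) + ε • y‖ ^ 2
      = 1 + 2 * ε * ⟪k', y⟫ + ε ^ 2 * ‖y‖ ^ 2 := by
    intro ε
    rw [norm_add_sq_real, norm_coe, real_inner_smul_right, norm_smul, mul_pow, Real.norm_eq_abs,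
      sq_abs]
    ring
  set g := ⟪k', y⟫
  set d := ⟪k, y⟫
  rcases le_or_gt 0 c with h0 | h0
  · have h1 := key 1 one_pos
    have h2 : 1 + g ≤ ‖(k' : EuclideanSpace ℝ (Fin 3)) + (1 : ℝ) • y‖ := by
      have := real_inner_le_norm (k' : EuclideanSpace ℝ (Fin 3))
        ((k' : EuclideanSpace ℝ (Fin 3)) + (1 : ℝ) • y)
      rw [inner_add_right, inner_self_coe, real_inner_smul_right, norm_coe] at this
      linarith
    nlinarith
  · have hY : 0 < -c * ‖y‖ ^ 2 + 1 := by nlinarith [sq_nonneg ‖y‖]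
    -- For c < 0 the norm needs an upper bound, whose quadratic term is −c‖y‖²ε²/2; this ε makes
    -- −c‖y‖²ε equal to cg − d − ε, too small to offset the linear gain.
    have hε : 0 < (c * g - d) / (-c * ‖y‖ ^ 2 + 1) := div_pos (by linarith) hY
    have h1 := key _ hε
    have h2 := hsq ((c * g - d) / (-c * ‖y‖ ^ 2 + 1))
    have h3 : (c * g - d) / (-c * ‖y‖ ^ 2 + 1) * (-c * ‖y‖ ^ 2 + 1) = c * g - d :=
      div_mul_cancel₀ _ hY.ne'
    set ε := (c * g - d) / (-c * ‖y‖ ^ 2 + 1)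
    set N := ‖(k' : EuclideanSpace ℝ (Fin 3)) + ε • y‖
    have h4 : N ≤ 1 + ε * g + ε ^ 2 * ‖y‖ ^ 2 / 2 := by nlinarith [sq_nonneg (N - 1)]
    have h5 : c * (1 + ε * g + ε ^ 2 * ‖y‖ ^ 2 / 2) ≤ c * N := mul_le_mul_of_nonpos_left h4 h0.le
    have h6 : ε * (c * g - d) ≤ ε * (-c * ‖y‖ ^ 2 * ε / 2) := by nlinarith
    have h7 : c * g - d ≤ -c * ‖y‖ ^ 2 * ε / 2 := le_of_mul_le_mul_left h6 hε
    have h8 : 0 ≤ -c * ‖y‖ ^ 2 * ε := by have := neg_pos.2 h0; positivity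
    nlinarith

/-! ### Coordinates and semicircle centers -/

/-- A unit vector orthogonal to two given vectors. -/
lemma exists_orthogonal (u v : EuclideanSpace ℝ (Fin 3)) :
    ∃ j : S2, ⟪u, j⟫ = 0 ∧ ⟪v, j⟫ = 0 := by
  have h : Module.finrank ℝ (Submodule.span ℝ {u, v}) < Module.finrank ℝ (EuclideanSpace ℝ (Fin 3)) := by
    rw [finrank_euclideanSpace_fin]
    have := finrank_span_finset_le_card (R := ℝ) ({u, v} : Finset (EuclideanSpace ℝ (Fin 3)))
    have h2 : ({u, v} : Finset (EuclideanSpace ℝ (Fin 3))).card ≤ 2 := Finset.card_le_two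
    push_cast at this
    change Module.finrank ℝ (Submodule.span ℝ {u, v}) ≤ _ at this
    omega
  have hne : (Submodule.span ℝ {u, v})ᗮ ≠ ⊥ := by
    intro e
    rw [Submodule.orthogonal_eq_bot_iff] at e
    rw [e, finrank_top] at h
    exact lt_irrefl _ h
  obtain ⟨w, hw, hw0⟩ := Submodule.exists_mem_ne_zero_of_ne_bot hne
  obtain ⟨j, hj⟩ := exists_sphere_smul hw0
  have hn := norm_ne_zero_iff.2 hw0
  have hu := (Submodule.mem_orthogonal _ w).1 hw u (Submodule.subset_span (by simp))
  have hv := (Submodule.mem_orthogonal _ w).1 hw v (Submodule.subset_span (by simp))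
  rw [hj, real_inner_smul_right] at hu hv
  exact ⟨j, (mul_eq_zero.1 hu).resolve_left hn, (mul_eq_zero.1 hv).resolve_left hn⟩

lemma linearIndependent_of_orthogonal {a x y : S2} (hx : ⟪a, x⟫ = 0) (hy : ⟪a, y⟫ = 0)
    (hxy : 0 < 1 - ⟪x, y⟫ ^ 2) :
    LinearIndependent ℝ ![(a : EuclideanSpace ℝ (Fin 3)), (x : EuclideanSpace ℝ (Fin 3)),
      (y : EuclideanSpace ℝ (Fin 3))] := by
  rw [Fintype.linearIndependent_iff]
  intro g hg
  rw [Fin.sum_univ_three] at hg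
  simp only [Matrix.cons_val_zero, Matrix.cons_val_one, Matrix.cons_val_two,
    Matrix.tail_cons, Matrix.head_cons] at hg
  have e0 := congrArg (fun v => ⟪a, v⟫) hg
  have e1 := congrArg (fun v => ⟪x, v⟫) hg
  have e2 := congrArg (fun v => ⟪y, v⟫) hg
  simp only [inner_add_right, real_inner_smul_right, inner_zero_right, inner_self_coe, hx, hy,
    real_inner_comm (a : EuclideanSpace ℝ (Fin 3)) (x : EuclideanSpace ℝ (Fin 3)),
    real_inner_comm (a : EuclideanSpace ℝ (Fin 3)) (y : EuclideanSpace ℝ (Fin 3)),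
    real_inner_comm (x : EuclideanSpace ℝ (Fin 3)) (y : EuclideanSpace ℝ (Fin 3))] at e0 e1 e2
  have h1 : (1 - ⟪x, y⟫ ^ 2) * g 1 = 0 := by linear_combination e1 - ⟪x, y⟫ * e2
  have h1' := (mul_eq_zero.1 h1).resolve_left hxy.ne'
  have h2' : g 2 = 0 := by rw [h1'] at e2; linarith
  intro i
  fin_cases i
  · simpa using e0
  · exact h1'
  · exact h2'

lemma exists_coordinates {a x y : S2} (hx : ⟪a, x⟫ = 0) (hy : ⟪a, y⟫ = 0)
    (hxy : 0 < 1 - ⟪x, y⟫ ^ 2) (v : EuclideanSpace ℝ (Fin 3)) :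
    ∃ r s t : ℝ, v = r • (a : EuclideanSpace ℝ (Fin 3)) + s • (x : EuclideanSpace ℝ (Fin 3))
      + t • (y : EuclideanSpace ℝ (Fin 3)) := by
  have h := linearIndependent_of_orthogonal hx hy hxy
  let b := basisOfLinearIndependentOfCardEqFinrank h (by simp)
  refine ⟨b.repr v 0, b.repr v 1, b.repr v 2, ?_⟩
  have := b.sum_repr v
  rw [Fin.sum_univ_three] at this
  simpa [b] using this.symm

lemma exists_center {g h : S2} (hl : IsLune g h) :
    ∃ a : S2, √(1 - ⟪g, h⟫ ^ 2) • (a : EuclideanSpace ℝ (Fin 3)) =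
      (h : EuclideanSpace ℝ (Fin 3)) - ⟪g, h⟫ • (g : EuclideanSpace ℝ (Fin 3)) := by
  have hpos := hl.one_sub_sq_pos
  have hn : ‖(h : EuclideanSpace ℝ (Fin 3)) - ⟪g, h⟫ • (g : EuclideanSpace ℝ (Fin 3))‖
      = √(1 - ⟪g, h⟫ ^ 2) := by
    rw [eq_comm, Real.sqrt_eq_iff_mul_self_eq hpos.le (norm_nonneg _), ← pow_two, norm_sub_sq_real,
      norm_coe, real_inner_smul_right, norm_smul, norm_coe, Real.norm_eq_abs, mul_one, sq_abs,
      real_inner_comm]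
    ring
  have hv : (h : EuclideanSpace ℝ (Fin 3)) - ⟪g, h⟫ • (g : EuclideanSpace ℝ (Fin 3)) ≠ 0 := by
    rw [← norm_ne_zero_iff, hn]; exact (Real.sqrt_pos.2 hpos).ne'
  obtain ⟨a, ha⟩ := exists_sphere_smul hv
  exact ⟨a, by rw [← hn]; exact ha.symm⟩

/-- The center of G/H is the normalized component of h orthogonal to g; this replaces the equality
of sets in the definition by a linear equation. -/
lemma isSemicircleCenter_iff {g h a : S2} (hl : IsLune g h) :
    IsSemicircleCenter g h a ↔ √(1 - ⟪g, h⟫ ^ 2) • (a : EuclideanSpace ℝ (Fin 3)) =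
      (h : EuclideanSpace ℝ (Fin 3)) - ⟪g, h⟫ • (g : EuclideanSpace ℝ (Fin 3)) := by
  have hpos := hl.one_sub_sq_pos
  have hsp := Real.sqrt_pos.2 hpos
  constructor
  · rintro ⟨h1, h2⟩
    rw [mem_greatCircle] at h1
    have hx : ∀ x : S2, ⟪g, x⟫ = 0 → (0 ≤ ⟪h, x⟫ ↔ 0 ≤ ⟪a, x⟫) := by
      intro x hgx
      have := Set.ext_iff.1 h2 x
      simpa only [semicircle, Set.mem_inter_iff, Set.mem_ofPred_eq, mem_greatCircle, hgx,
        mem_hemisphere, sdist_le_pi_div_two, true_and] using this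
    obtain ⟨j, hgj, haj⟩ := exists_orthogonal g a
    -- Both j and −j are at distance π/2 from a, so both lie on the semicircle and hence in H(h).
    -- Thus h lies in the plane of g and a.
    have hhj : ⟪h, j⟫ = 0 := by
      have e1 := (hx j hgj).2 haj.ge
      have e2 := (hx (-j) (by rw [coe_neg_sphere, inner_neg_right, hgj, neg_zero])).2
        (by rw [coe_neg_sphere, inner_neg_right, haj, neg_zero])
      rw [coe_neg_sphere, inner_neg_right] at e2
      linarith
    obtain ⟨r, s, t, e⟩ := exists_coordinates (a := g) h1 hgj (by rw [haj]; norm_num) h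
    have t0 : t = 0 := by
      have := congrArg (fun v => ⟪j, v⟫) e
      simp only [inner_add_right, real_inner_smul_right, inner_self_coe] at this
      rw [real_inner_comm, hhj, real_inner_comm, hgj, real_inner_comm, haj] at this
      linarith
    have r0 : r = ⟪g, h⟫ := by
      have := congrArg (fun v => ⟪g, v⟫) e
      simp only [inner_add_right, real_inner_smul_right, inner_self_coe, h1, hgj] at this
      linarith
    have s0 : 0 ≤ s := by
      have e1 := (hx a h1).2 (by rw [inner_self_coe]; norm_num)
      rw [e, inner_add_left, inner_add_left, real_inner_smul_left, real_inner_smul_left,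
        real_inner_smul_left, h1, inner_self_coe, t0] at e1
      linarith
    have hs : s ^ 2 = 1 - ⟪g, h⟫ ^ 2 := by
      have e1 := inner_self_coe h
      nth_rw 2 [e] at e1
      rw [inner_add_right, inner_add_right, real_inner_smul_right, real_inner_smul_right,
        real_inner_smul_right, t0] at e1
      have e2 := congrArg (fun v => ⟪a, v⟫) e
      simp only [inner_add_right, real_inner_smul_right, inner_self_coe, t0] at e2
      rw [real_inner_comm (g : EuclideanSpace ℝ (Fin 3)) (a : EuclideanSpace ℝ (Fin 3)), h1] at e2
      rw [real_inner_comm (a : EuclideanSpace ℝ (Fin 3)) (h : EuclideanSpace ℝ (Fin 3)), e2,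
        real_inner_comm (g : EuclideanSpace ℝ (Fin 3)) (h : EuclideanSpace ℝ (Fin 3)), r0] at e1
      nlinarith
    rw [← hs, Real.sqrt_sq s0]
    nth_rw 1 [e]
    rw [r0, t0]
    simp
  · intro e
    have hi : ∀ x : S2, √(1 - ⟪g, h⟫ ^ 2) * ⟪a, x⟫ = ⟪h, x⟫ - ⟪g, h⟫ * ⟪g, x⟫ := by
      intro x
      rw [← real_inner_smul_left, e, inner_sub_left, real_inner_smul_left]
    constructor
    · rw [mem_greatCircle]
      have := hi g
      rw [inner_self_coe, real_inner_comm (g : EuclideanSpace ℝ (Fin 3)) (h : EuclideanSpace ℝ (Fin 3)),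
        mul_one, sub_self] at this
      rw [real_inner_comm]
      exact (mul_eq_zero.1 this).resolve_left hsp.ne'
    · ext x
      simp only [semicircle, Set.mem_inter_iff, Set.mem_ofPred_eq, mem_greatCircle,
        mem_hemisphere, sdist_le_pi_div_two]
      refine and_congr_right fun hx => ?_
      have := hi x
      rw [hx, mul_zero, sub_zero] at this
      rw [← this]
      exact mul_nonneg_iff_of_pos_left hsp

lemma sdist_centers {g h a b : S2} (hl : IsLune g h) (ha : IsSemicircleCenter g h a)
    (hb : IsSemicircleCenter h g b) : sdist a b = π - sdist g h := by
  have hpos := hl.one_sub_sq_pos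
  have e1 := (isSemicircleCenter_iff hl).1 ha
  have e2 := (isSemicircleCenter_iff hl.symm).1 hb
  have hc := real_inner_comm (g : EuclideanSpace ℝ (Fin 3)) (h : EuclideanSpace ℝ (Fin 3))
  rw [hc] at e2
  rw [sdist_eq_arccos, sdist_eq_arccos, ← Real.arccos_neg]
  congr 1
  have e3 : (√(1 - ⟪g, h⟫ ^ 2) * √(1 - ⟪g, h⟫ ^ 2)) * ⟪a, b⟫ =
      (1 - ⟪g, h⟫ ^ 2) * (-⟪g, h⟫) := by
    rw [mul_assoc, ← real_inner_smul_right, ← real_inner_smul_left, e1, e2]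
    simp only [inner_sub_left, inner_sub_right, real_inner_smul_left, real_inner_smul_right,
      inner_self_coe]
    rw [hc]
    ring
  rw [Real.mul_self_sqrt hpos.le] at e3
  exact mul_left_cancel₀ hpos.ne' e3

lemma isLuneThickness_iff {g h : S2} {t : ℝ} :
    IsLuneThickness g h t ↔ IsLune g h ∧ t = π - sdist g h := by
  constructor
  · rintro ⟨hl, a, b, ha, hb, rfl⟩
    exact ⟨hl, sdist_centers hl ha hb⟩
  · rintro ⟨hl, rfl⟩
    obtain ⟨a, ha⟩ := exists_center hl
    obtain ⟨b, hb⟩ := exists_center hl.symm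
    have ha' := (isSemicircleCenter_iff hl).2 ha
    have hb' := (isSemicircleCenter_iff hl.symm).2 hb
    exact ⟨hl, a, b, ha', hb', (sdist_centers hl ha' hb').symm⟩

/-! ### Width and thickness as extremal distances in the polar set -/

lemma isLune_of_mem_polar {C : Set S2} (hC : IsConvexBody C) {k k' : S2} (hk : k ∈ polar C)
    (hk' : k' ∈ polar C) (hne : k ≠ k') : IsLune k k' :=
  ⟨hne, fun e => neg_notMem_polar hC.interior_nonempty hk' (e ▸ hk)⟩

lemma nonempty_of_isConvexBody {C : Set S2} (hC : IsConvexBody C) : C.Nonempty :=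
  hC.interior_nonempty.mono interior_subset

/-- The semicircle centers of a lune whose bounding hemisphere is farthest in the polar set. -/
lemma semicircleCenter_mem {C : Set S2} (hC : IsConvexBody C) {k k' p : S2} (hl : IsLune k' k)
    (hk' : k' ∈ polar C) (hmin : ∀ l ∈ polar C, ⟪k, k'⟫ ≤ ⟪k, l⟫)
    (hp : IsSemicircleCenter k' k p) : p ∈ C := by
  refine center_mem (nonempty_of_isConvexBody hC) hC.closed hC.convex hk' hmin
    (Real.sqrt_pos.2 hl.one_sub_sq_pos) ?_
  rw [(isSemicircleCenter_iff hl).1 hp, real_inner_comm]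

lemma supports_of_isMin {C : Set S2} (hC : IsConvexBody C) {k k' : S2} (hl : IsLune k' k)
    (hk' : k' ∈ polar C) (hmin : ∀ l ∈ polar C, ⟪k, k'⟫ ≤ ⟪k, l⟫) : Supports k' C := by
  obtain ⟨p, hp⟩ := exists_center hl
  have hp' := (isSemicircleCenter_iff hl).2 hp
  exact ⟨p, (supportsAt_iff hC.closed).2
    ⟨hk', semicircleCenter_mem hC hl hk' hmin hp', mem_greatCircle.1 hp'.1⟩⟩

lemma exists_min_pair {C : Set S2} {k₀ : S2} (h₀ : k₀ ∈ polar C) :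
    ∃ k ∈ polar C, ∃ k' ∈ polar C, ∀ l ∈ polar C, ∀ l' ∈ polar C, ⟪k, k'⟫ ≤ ⟪l, l'⟫ := by
  have hcomp : IsCompact (polar C ×ˢ polar C) :=
    (isClosed_polar C).isCompact.prod (isClosed_polar C).isCompact
  have hcont : Continuous fun q : S2 × S2 =>
      inner ℝ (q.1 : EuclideanSpace ℝ (Fin 3)) (q.2 : EuclideanSpace ℝ (Fin 3)) := by fun_prop
  obtain ⟨⟨k, k'⟩, ⟨hk, hk'⟩, hmin⟩ := hcomp.exists_isMinOn ⟨(k₀, k₀), h₀, h₀⟩ hcont.continuousOn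
  exact ⟨k, hk, k', hk', fun l hl l' hl' => hmin (Set.mk_mem_prod hl hl')⟩

lemma exists_min {C : Set S2} {k₀ : S2} (h₀ : k₀ ∈ polar C) (k : S2) :
    ∃ k' ∈ polar C, ∀ l ∈ polar C, ⟪k, k'⟫ ≤ ⟪k, l⟫ := by
  have hcont : Continuous fun q : S2 =>
      inner ℝ (k : EuclideanSpace ℝ (Fin 3)) (q : EuclideanSpace ℝ (Fin 3)) := by fun_prop
  obtain ⟨k', hk', hmin⟩ :=
    (isClosed_polar C).isCompact.exists_isMinOn ⟨k₀, h₀⟩ hcont.continuousOn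
  exact ⟨k', hk', fun l hl => hmin hl⟩

lemma Supports.mem_polar {C : Set S2} {m : S2} (h : Supports m C) : m ∈ polar C := by
  obtain ⟨p, -, h, -⟩ := h
  exact subset_hemisphere_iff.1 h

lemma bddBelow_widths (C : Set S2) (k : S2) :
    BddBelow {t : ℝ | ∃ h : S2, Supports h C ∧ IsLuneThickness k h t} := by
  refine ⟨0, ?_⟩
  rintro t ⟨h, -, -, a, b, -, -, rfl⟩
  exact InnerProductGeometry.angle_nonneg _ _

lemma width_nonneg (C : Set S2) (k : S2) : 0 ≤ width C k := by
  refine Real.sInf_nonneg ?_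
  rintro t ⟨h, -, -, a, b, -, -, rfl⟩
  exact InnerProductGeometry.angle_nonneg _ _

lemma width_le {C : Set S2} {k h : S2} (hl : IsLune k h) (hh : Supports h C) :
    width C k ≤ π - sdist k h :=
  csInf_le (bddBelow_widths C k) ⟨h, hh, isLuneThickness_iff.2 ⟨hl, rfl⟩⟩

lemma thickness_le_width {C : Set S2} {k : S2} (hk : Supports k C) : thickness C ≤ width C k := by
  refine csInf_le ⟨0, ?_⟩ ⟨k, hk, rfl⟩
  rintro w ⟨k, -, rfl⟩
  exact width_nonneg C k

lemma exists_supporting_min_pair {C : Set S2} (hC : IsConvexBody C) {x y : S2} (hxy : x ≠ y)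
    (hx : x ∈ polar C) (hy : y ∈ polar C) :
    ∃ k k' : S2, Supports k C ∧ Supports k' C ∧ IsLune k k' ∧
      ∀ l ∈ polar C, ∀ l' ∈ polar C, ⟪k, k'⟫ ≤ ⟪l, l'⟫ := by
  obtain ⟨k, hk, k', hk', hmin⟩ := exists_min_pair hx
  have hne : k ≠ k' := by
    rintro rfl
    have h1 := hmin x hx y hy
    rw [inner_self_coe] at h1
    exact absurd (inner_lt_one_of_ne hxy) h1.not_gt
  have hl := isLune_of_mem_polar hC hk hk' hne
  refine ⟨k, k', supports_of_isMin hC hl hk fun l hl' => ?_,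
    supports_of_isMin hC hl.symm hk' fun l hl' => hmin k hk l hl', hl, hmin⟩
  rw [real_inner_comm]
  exact hmin l hl' k' hk' |>.trans_eq (real_inner_comm _ _)

/-- The hemispheres of a farthest polar pair touch the body, so lunes of hemispheres that merely
contain the body are no thinner than Δ. -/
lemma thickness_le {C : Set S2} (hC : IsConvexBody C) {k k' : S2} (hne : k ≠ k')
    (hk : k ∈ polar C) (hk' : k' ∈ polar C) : thickness C ≤ π - sdist k k' := by
  obtain ⟨l, l', hl, hl', hlune, hmin⟩ := exists_supporting_min_pair hC hne hk hk'
  have h1 := (thickness_le_width hl).trans (width_le hlune hl')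
  have h2 : sdist k k' ≤ sdist l l' := by
    rw [sdist_eq_arccos, sdist_eq_arccos]
    exact Real.arccos_le_arccos (hmin k hk k' hk')
  linarith

lemma thickness_nonneg (C : Set S2) : 0 ≤ thickness C := by
  refine Real.sInf_nonneg ?_
  rintro w ⟨k, -, rfl⟩
  exact width_nonneg C k

lemma neg_cos_thickness_le_inner {C : Set S2} (hC : IsConvexBody C) {k k' : S2}
    (hk : k ∈ polar C) (hk' : k' ∈ polar C) : -Real.cos (thickness C) ≤ ⟪k, k'⟫ := by
  by_cases hne : k = k'
  · rw [hne, inner_self_coe]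
    linarith [Real.neg_one_le_cos (thickness C)]
  · rw [← Real.cos_pi_sub, ← cos_sdist]
    exact Real.cos_le_cos_of_nonneg_of_le_pi (InnerProductGeometry.angle_nonneg _ _)
      (by linarith [thickness_nonneg C]) (by linarith [thickness_le hC hne hk hk'])

/-- Converse to `thickness_le`. Two different polar points are needed because the infimum of the
empty set is 0 by convention: they make both infima, over K and over K', range over nonempty sets.
-/
lemma exists_of_thickness_lt {C : Set S2} (hC : IsConvexBody C) {x y : S2} (hxy : x ≠ y)
    (hx : x ∈ polar C) (hy : y ∈ polar C) {d : ℝ} (hd : thickness C < d) :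
    ∃ k ∈ polar C, ∃ k' ∈ polar C, π - sdist k k' < d := by
  obtain ⟨k₀, -, hk₀, -, -, -⟩ := exists_supporting_min_pair hC hxy hx hy
  have hne₀ : {w : ℝ | ∃ k : S2, Supports k C ∧ w = width C k}.Nonempty := ⟨_, k₀, hk₀, rfl⟩
  obtain ⟨w, ⟨k, hk, rfl⟩, hw⟩ := exists_lt_of_csInf_lt hne₀ hd
  obtain ⟨k', hk', hmin⟩ := exists_min hx k
  have hne : k ≠ k' := by
    rintro rfl
    have h1 : ∀ l ∈ polar C, k = l := fun l hl => by
      rw [← inner_eq_one_iff]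
      exact le_antisymm (inner_le_one _ _) ((inner_self_coe k).symm.trans_le (hmin l hl))
    exact hxy ((h1 x hx).symm.trans (h1 y hy))
  have hl := isLune_of_mem_polar hC hk.mem_polar hk' hne
  have hne₁ : {t : ℝ | ∃ h : S2, Supports h C ∧ IsLuneThickness k h t}.Nonempty :=
    ⟨_, k', supports_of_isMin hC hl.symm hk' hmin, isLuneThickness_iff.2 ⟨hl, rfl⟩⟩
  obtain ⟨t, ⟨h, hh, ht⟩, htd⟩ := exists_lt_of_csInf_lt hne₁ hw
  obtain ⟨-, rfl⟩ := isLuneThickness_iff.1 ht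
  exact ⟨k, hk.mem_polar, h, hh.mem_polar, htd⟩

lemma IsStar.width_eq {C : Set S2} {k k' : S2} (h : IsStar C k k') :
    width C k = π - sdist k k' := by
  obtain ⟨hs, t, ht, hmin⟩ := h
  obtain ⟨hl, rfl⟩ := isLuneThickness_iff.1 ht
  exact le_antisymm (width_le hl hs)
    (le_csInf ⟨_, k', hs, ht⟩ fun u ⟨h, hh, hu⟩ => hmin h u hh hu)

lemma IsStar.isLune {C : Set S2} {k k' : S2} (h : IsStar C k k') : IsLune k k' := by
  obtain ⟨-, t, ht, -⟩ := h
  exact ht.1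

/-! ### Cutting a body by a hemisphere -/

/-- A convex body cut by a hemisphere is a convex body if the hemisphere contains a point of the
body in its interior. -/
lemma isConvexBody_inter_hemisphere {R : Set S2} (hR : IsConvexBody R) {a h : S2} (ha : a ∈ R)
    (hpos : 0 < ⟪h, a⟫) : IsConvexBody (R ∩ hemisphere h) := by
  refine ⟨?_, ⟨?_, ?_⟩, ?_⟩
  · refine hR.closed.inter ?_
    have : hemisphere h = {x : S2 | 0 ≤ inner ℝ (h : EuclideanSpace ℝ (Fin 3)) x} := by
      ext x; exact mem_hemisphere
    rw [this]
    exact isClosed_le continuous_const (by fun_prop)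
  · exact fun x hx hx' => hR.convex.1 x hx.1 hx'.1
  · intro x hx y hy z hz
    refine ⟨hR.convex.2 x hx.1 y hy.1 hz, ?_⟩
    obtain ⟨s, t, hs, ht, e⟩ := hz
    rw [mem_hemisphere, e, inner_add_right, real_inner_smul_right, real_inner_smul_right]
    exact add_nonneg (mul_nonneg hs (mem_hemisphere.1 hx.2))
      (mul_nonneg ht (mem_hemisphere.1 hy.2))
  · obtain ⟨c, hc⟩ := hR.interior_nonempty
    have hO : IsOpen {v : EuclideanSpace ℝ (Fin 3) | 0 < ⟪h, v⟫} :=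
      isOpen_lt continuous_const (by fun_prop)
    -- A convex set with interior points lies in the closure of its interior, so the open half-space
    -- around a meets that interior.
    have hcl : (a : EuclideanSpace ℝ (Fin 3)) ∈ closure (interior (coneOver R)) := by
      rw [(convex_coneOver hR.convex).closure_interior_eq_closure_of_nonempty_interior
        ⟨_, coe_mem_interior_coneOver hc⟩]
      exact subset_closure (coe_mem_coneOver ha)
    obtain ⟨v, hv1, hv2⟩ := mem_closure_iff.1 hcl _ hO hpos
    have hv0 : v ≠ 0 := by
      rintro rfl
      simp at hv1
    obtain ⟨x, hx⟩ := exists_sphere_smul hv0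
    have hn : 0 < ‖v‖ := norm_pos_iff.2 hv0
    refine ⟨x, mem_interior.2 ⟨(fun y : S2 => ‖v‖ • (y : EuclideanSpace ℝ (Fin 3))) ⁻¹'
      ({v | 0 < ⟪h, v⟫} ∩ interior (coneOver R)), ?_, ?_, ?_⟩⟩
    · rintro y ⟨hy1, hy2⟩
      refine ⟨mem_of_smul_mem_coneOver hn (interior_subset hy2), mem_hemisphere.2 ?_⟩
      have hy1' : 0 < ⟪h, (‖v‖ • (y : EuclideanSpace ℝ (Fin 3)))⟫ := hy1
      rw [real_inner_smul_right] at hy1'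
      exact (pos_of_mul_pos_right hy1' hn.le).le
    · exact (hO.inter isOpen_interior).preimage (by fun_prop)
    · rw [Set.mem_preimage, ← hx]
      exact ⟨hv1, hv2⟩

/-- A hemisphere supporting `R ∩ H(h)` at a point off the great circle bounding `H(h)`
contains `R`. -/
lemma inner_eq_zero_of_notMem_polar {R : Set S2} (hR : IsConvexBody R) {h k p : S2}
    (hk : k ∈ polar (R ∩ hemisphere h)) (hkR : k ∉ polar R) (hp : p ∈ R ∩ hemisphere h)
    (hkp : ⟪k, p⟫ = 0) : ⟪h, p⟫ = 0 := by
  by_contra hne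
  have hpos : 0 < ⟪h, p⟫ := lt_of_le_of_ne (mem_hemisphere.1 hp.2) (Ne.symm hne)
  apply hkR
  intro x hx
  -- The ratio ε is small enough for p + εx to stay strictly inside H(h): ε(|⟨h, x⟩| + 1) = ⟨h, p⟩.
  -- Local support at p then extends to every x in R.
  have hq : 0 < ⟪h, p⟫ / (|⟪h, x⟫| + 1) := by positivity
  have hb : ⟪h, p⟫ / (|⟪h, x⟫| + 1) * (|⟪h, x⟫| + 1) = ⟪h, p⟫ :=
    div_mul_cancel₀ _ (by positivity)
  set ε := ⟪h, p⟫ / (|⟪h, x⟫| + 1)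
  have hv : 0 < ⟪h, ((p : EuclideanSpace ℝ (Fin 3)) + ε • (x : EuclideanSpace ℝ (Fin 3)))⟫ := by
    rw [inner_add_right, real_inner_smul_right]
    nlinarith [neg_abs_le ⟪h, x⟫]
  obtain ⟨z, hz, e⟩ := add_mem_coneOver hR.convex (coe_mem_coneOver hp.1)
    (smul_mem_coneOver hx hq.le)
  have hn := norm_nonneg ((p : EuclideanSpace ℝ (Fin 3)) + ε • (x : EuclideanSpace ℝ (Fin 3)))
  have hzh : 0 < ⟪h, z⟫ := by
    rw [e, real_inner_smul_right] at hv
    exact pos_of_mul_pos_right hv hn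
  have h1 := hk z ⟨hz, mem_hemisphere.2 hzh.le⟩
  have h2 : 0 ≤ ⟪k, ((p : EuclideanSpace ℝ (Fin 3)) + ε • (x : EuclideanSpace ℝ (Fin 3)))⟫ := by
    rw [e, real_inner_smul_right]
    exact mul_nonneg hn h1
  rw [inner_add_right, real_inner_smul_right, hkp, zero_add] at h2
  exact nonneg_of_mul_nonneg_right h2 hq

lemma inner_sq_add_inner_sq_le_one {a b : S2} (hab : ⟪a, b⟫ = 0) (p : S2) :
    ⟪a, p⟫ ^ 2 + ⟪b, p⟫ ^ 2 ≤ 1 := by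
  have h := real_inner_self_nonneg (x := (p : EuclideanSpace ℝ (Fin 3))
    - ⟪a, p⟫ • (a : EuclideanSpace ℝ (Fin 3)) - ⟪b, p⟫ • (b : EuclideanSpace ℝ (Fin 3)))
  simp only [inner_sub_left, inner_sub_right, real_inner_smul_left, real_inner_smul_right,
    inner_self_coe, hab] at h
  rw [real_inner_comm (a : EuclideanSpace ℝ (Fin 3)) (b : EuclideanSpace ℝ (Fin 3)),
    real_inner_comm (a : EuclideanSpace ℝ (Fin 3)) (p : EuclideanSpace ℝ (Fin 3)),
    real_inner_comm (b : EuclideanSpace ℝ (Fin 3)) (p : EuclideanSpace ℝ (Fin 3)), hab] at h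
  linarith

/-! ### The planar picture and the width estimate -/

/-- The normals of a supporting line between two tangents of a circle lie between the normals of
the tangents. -/
lemma nonneg_of_support {X Y s t c α β : ℝ} (hX0 : 0 ≤ X) (hY0 : 0 ≤ Y) (hX : X ≤ 1) (hY : Y ≤ 1)
    (hs : 0 < s) (ht : 0 < t) (hst : s ^ 2 + t ^ 2 + 2 * s * t * c = 1) (hc : c ^ 2 < 1)
    (hXY : s * X + t * Y = 1) (h1 : α * c + β ≤ α * X + β * Y)
    (h0 : 0 ≤ α * X + β * Y) : 0 ≤ α := by
  -- With m = s m₁ + t m₂ of norm 1, the left side is ⟨m, m₂⟩, and in the next claim ⟨m, m₁⟩.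
  have a1 : t + s * c < 1 := by
    have : (t + s * c) ^ 2 < 1 := by nlinarith [mul_pos (mul_pos hs hs) (sub_pos.2 hc)]
    nlinarith
  have a2 : s + t * c < 1 := by
    have : (s + t * c) ^ 2 < 1 := by nlinarith [mul_pos (mul_pos ht ht) (sub_pos.2 hc)]
    nlinarith
  have b1 : c < X := by
    have : s * c < s * X := by nlinarith
    exact lt_of_mul_lt_mul_left this hs.le
  have b2 : c < Y := by
    have : t * c < t * Y := by nlinarith
    exact lt_of_mul_lt_mul_left this ht.le
  by_contra hα
  push Not at hα
  rcases le_or_gt 0 β with hβ | hβ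
  · nlinarith [mul_neg_of_neg_of_pos hα (sub_pos.2 b1), mul_nonneg hβ (sub_nonneg.2 hY)]
  · have c1 : α * X ≤ 0 := mul_nonpos_of_nonpos_of_nonneg hα.le hX0
    have c2 : β * Y ≤ 0 := mul_nonpos_of_nonpos_of_nonneg hβ.le hY0
    have d1 : X = 0 := (mul_eq_zero.1 (by linarith : α * X = 0)).resolve_left hα.ne
    have d2 : Y = 0 := (mul_eq_zero.1 (by linarith : β * Y = 0)).resolve_left hβ.ne
    rw [d1, d2] at hXY
    linarith

/-- The planar picture in the gnomonic projection from `a`: a hemisphere with center `k` that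
contains `a`, `b₁`, `b₂` and touches a point `p` of the tangent of the circle at `m` between the
tangents at `b₁` and `b₂` has its normal between `m₁` and `m₂`. -/
lemma exists_nonneg_coordinates {a m₁ m₂ p k : S2} {s t sn cs : ℝ} (hsn : 0 < sn) (hcs : 0 < cs)
    (h₁ : ⟪a, m₁⟫ = 0) (h₂ : ⟪a, m₂⟫ = 0) (hc : ⟪m₁, m₂⟫ ^ 2 < 1) (hs : 0 < s) (ht : 0 < t)
    (hst : s ^ 2 + t ^ 2 + 2 * s * t * ⟪m₁, m₂⟫ = 1)
    (hp : sn * ⟪a, p⟫ = cs * (s * ⟪m₁, p⟫ + t * ⟪m₂, p⟫))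
    (hp₁ : 0 ≤ ⟪m₁, p⟫) (hp₂ : 0 ≤ ⟪m₂, p⟫) (hap : 0 < ⟪a, p⟫)
    (hq₁ : cs * ⟪m₁, p⟫ ≤ sn * ⟪a, p⟫) (hq₂ : cs * ⟪m₂, p⟫ ≤ sn * ⟪a, p⟫)
    (hkp : ⟪k, p⟫ = 0) (hka : 0 ≤ ⟪k, a⟫) (hk₁ : 0 ≤ cs * ⟪k, a⟫ + sn * ⟪k, m₁⟫)
    (hk₂ : 0 ≤ cs * ⟪k, a⟫ + sn * ⟪k, m₂⟫) :
    ∃ α β : ℝ, 0 ≤ α ∧ 0 ≤ β ∧ ⟪k, a⟫ • (a : EuclideanSpace ℝ (Fin 3)) - (k : EuclideanSpace ℝ (Fin 3))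
      = α • (m₁ : EuclideanSpace ℝ (Fin 3)) + β • (m₂ : EuclideanSpace ℝ (Fin 3)) := by
  obtain ⟨r, y, z, e⟩ := exists_coordinates h₁ h₂ (sub_pos.2 hc) k
  have i1 := real_inner_comm (m₁ : EuclideanSpace ℝ (Fin 3)) (a : EuclideanSpace ℝ (Fin 3))
  have i2 := real_inner_comm (m₂ : EuclideanSpace ℝ (Fin 3)) (a : EuclideanSpace ℝ (Fin 3))
  have i3 := real_inner_comm (m₁ : EuclideanSpace ℝ (Fin 3)) (m₂ : EuclideanSpace ℝ (Fin 3))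
  have ek : ∀ w : EuclideanSpace ℝ (Fin 3), ⟪k, w⟫ = r * ⟪a, w⟫ + y * ⟪m₁, w⟫ + z * ⟪m₂, w⟫ := by
    intro w
    rw [e, inner_add_left, inner_add_left, real_inner_smul_left, real_inner_smul_left,
      real_inner_smul_left]
  have er : ⟪k, a⟫ = r := by
    rw [ek, inner_self_coe, ← i1, ← i2, h₁, h₂]; ring
  have e1 : ⟪k, m₁⟫ = y + z * ⟪m₁, m₂⟫ := by
    rw [ek, inner_self_coe, h₁, i3]; ring
  have e2 : ⟪k, m₂⟫ = y * ⟪m₁, m₂⟫ + z := by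
    rw [ek, inner_self_coe, h₂]; ring
  rw [ek] at hkp
  rw [er] at hka hk₁ hk₂
  rw [e1] at hk₁
  rw [e2] at hk₂
  set A := ⟪a, p⟫
  set x₁ := ⟪m₁, p⟫
  set x₂ := ⟪m₂, p⟫
  set c := ⟪m₁, m₂⟫
  have hN : 0 < sn * A := mul_pos hsn hap
  -- Gnomonic coordinates p/⟨a, p⟩, rescaled by cs/sn so that the circle of radius Δ about a becomes
  -- the unit circle. The tangent at m reads sX + tY = 1.
  set X := cs * x₁ / (sn * A) with hX
  set Y := cs * x₂ / (sn * A) with hY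
  have hXm : X * (sn * A) = cs * x₁ := div_mul_cancel₀ _ hN.ne'
  have hYm : Y * (sn * A) = cs * x₂ := div_mul_cancel₀ _ hN.ne'
  have hX0 : 0 ≤ X := by positivity
  have hY0 : 0 ≤ Y := by positivity
  have hX1 : X ≤ 1 := (div_le_one hN).2 hq₁
  have hY1 : Y ≤ 1 := (div_le_one hN).2 hq₂
  have hXY : s * X + t * Y = 1 := by
    apply mul_right_cancel₀ hN.ne'
    linear_combination s * hXm + t * hYm - hp
  have hv : (-y * X + -z * Y) * sn = cs * r := by
    apply mul_right_cancel₀ hap.ne'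
    linear_combination -y * hXm - z * hYm - cs * hkp
  have f0 : 0 ≤ -y * X + -z * Y :=
    nonneg_of_mul_nonneg_left (hv ▸ mul_nonneg hcs.le hka) hsn
  have f1 : -y + -z * c ≤ -y * X + -z * Y := by
    refine le_of_mul_le_mul_right ?_ hsn
    rw [hv]; linarith
  have f2 : -y * c + -z ≤ -y * X + -z * Y := by
    refine le_of_mul_le_mul_right ?_ hsn
    rw [hv]; linarith
  refine ⟨-y, -z, nonneg_of_support hX0 hY0 hX1 hY1 hs ht hst hc hXY f2 f0,
    nonneg_of_support (β := -y) hY0 hX0 hY1 hX1 ht hs (by linarith) hc (by linarith)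
      (by linarith) (by linarith), ?_⟩
  rw [er, e]
  module

/-- The width estimate: a strip whose arc starts in `p` has width at least `|ap|`. -/
lemma neg_inner_le_inner_of_centers {a k k' p q : S2} {S : ℝ} (hS : 0 < S)
    (hS2 : S ^ 2 = 1 - ⟪k, k'⟫ ^ 2) (hneg : ⟪k, k'⟫ < 0)
    (hp : S • (p : EuclideanSpace ℝ (Fin 3)) = (k : EuclideanSpace ℝ (Fin 3)) - ⟪k, k'⟫ • (k' : EuclideanSpace ℝ (Fin 3)))
    (hq : S • (q : EuclideanSpace ℝ (Fin 3)) = (k' : EuclideanSpace ℝ (Fin 3)) - ⟪k, k'⟫ • (k : EuclideanSpace ℝ (Fin 3)))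
    (hkp : ⟪k', p⟫ = 0) (hap : 0 < ⟪a, p⟫) (hka : 0 ≤ ⟪k, a⟫)
    (hu : 0 ≤ ⟪(⟪k', a⟫ • (a : EuclideanSpace ℝ (Fin 3)) - (k' : EuclideanSpace ℝ (Fin 3))), q⟫) :
    -⟪k, k'⟫ ≤ ⟪a, p⟫ := by
  have hB := inner_sq_add_inner_sq_le_one hkp a
  have ep := congrArg (fun v => ⟪a, v⟫) hp
  have eq := congrArg (fun v => ⟪a, v⟫) hq
  have eq' := congrArg (fun v => ⟪k', v⟫) hq
  simp only [inner_sub_right, real_inner_smul_right, inner_self_coe] at ep eq eq'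
  rw [real_inner_comm (k : EuclideanSpace ℝ (Fin 3)) (k' : EuclideanSpace ℝ (Fin 3))] at eq'
  rw [inner_sub_left, real_inner_smul_left] at hu
  rw [real_inner_comm (a : EuclideanSpace ℝ (Fin 3)) (p : EuclideanSpace ℝ (Fin 3))] at hB
  rw [real_inner_comm (a : EuclideanSpace ℝ (Fin 3)) (k' : EuclideanSpace ℝ (Fin 3))] at hB hu
  rw [real_inner_comm (a : EuclideanSpace ℝ (Fin 3)) (k : EuclideanSpace ℝ (Fin 3))] at hka
  set A := ⟪a, p⟫
  set c := ⟪k, k'⟫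
  set l := ⟪a, k'⟫
  set x := ⟪a, k⟫
  have hK : ⟪k', q⟫ = S := by
    apply mul_left_cancel₀ hS.ne'
    linear_combination eq' - hS2
  have hQ : ⟪a, q⟫ = l * S - c * A := by
    apply mul_left_cancel₀ hS.ne'
    linear_combination eq + c * ep - l * hS2
  rw [hK, hQ] at hu
  -- The right side is ⟨k, a⟩.
  have h1 : 0 ≤ S * A + c * l := by linarith
  have h2 : S * (1 - l ^ 2) ≤ -c * l * A := by linarith
  have h3 : -c * l * A ≤ S * A ^ 2 := by nlinarith
  have h4 : 1 - l ^ 2 ≤ A ^ 2 := le_of_mul_le_mul_left (h2.trans h3) hS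
  -- Bessel's inequality for the orthonormal pair k', p gives the reverse of `h4`, so equality holds
  -- throughout: `h7` says that a is orthogonal to k, and then A = −c.
  have h5 : l ^ 2 = 1 - A ^ 2 := by linarith
  have h6 : -c * l * A = S * A ^ 2 := by
    refine le_antisymm h3 ?_
    rw [h5] at h2
    linarith
  have h7 : -c * l = S * A := by
    apply mul_right_cancel₀ hap.ne'
    linarith
  have h8 : c ^ 2 = A ^ 2 := by
    have : (c * l) ^ 2 = (S * A) ^ 2 := by rw [← h7]; ring
    rw [mul_pow, mul_pow, hS2, h5] at this
    linarith
  nlinarith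

/-! ### Using reducedness -/

set_option maxHeartbeats 1000000 in
lemma mem_polar_of_isReduced {R : Set S2} (hR : IsReduced R) {sn cs : ℝ}
    (hsn : 0 < sn) (hcs : 0 < cs) (hsc : sn ^ 2 + cs ^ 2 = 1) (hcos : cs = Real.cos (thickness R))
    (hΔ : thickness R ≤ π) {a m₁ m₂ b₁ b₂ n₁ n₂ m h : S2}
    (hm₁ : m₁ ∈ polar R) (hm₂ : m₂ ∈ polar R) (hn₁ : n₁ ∈ polar R) (hn₂ : n₂ ∈ polar R)
    (ha : a ∈ R) (hb₁ : b₁ ∈ R) (hb₂ : b₂ ∈ R) (hne : m₁ ≠ m₂)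
    (ham₁ : ⟪a, m₁⟫ = 0) (ham₂ : ⟪a, m₂⟫ = 0)
    (en₁ : (n₁ : EuclideanSpace ℝ (Fin 3)) = sn • (a : EuclideanSpace ℝ (Fin 3)) - cs • (m₁ : EuclideanSpace ℝ (Fin 3)))
    (en₂ : (n₂ : EuclideanSpace ℝ (Fin 3)) = sn • (a : EuclideanSpace ℝ (Fin 3)) - cs • (m₂ : EuclideanSpace ℝ (Fin 3)))
    (eb₁ : (b₁ : EuclideanSpace ℝ (Fin 3)) = cs • (a : EuclideanSpace ℝ (Fin 3)) + sn • (m₁ : EuclideanSpace ℝ (Fin 3)))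
    (eb₂ : (b₂ : EuclideanSpace ℝ (Fin 3)) = cs • (a : EuclideanSpace ℝ (Fin 3)) + sn • (m₂ : EuclideanSpace ℝ (Fin 3)))
    {s t : ℝ} (hs : 0 < s) (ht : 0 < t)
    (em : (m : EuclideanSpace ℝ (Fin 3)) = s • (m₁ : EuclideanSpace ℝ (Fin 3)) + t • (m₂ : EuclideanSpace ℝ (Fin 3)))
    (eh : (h : EuclideanSpace ℝ (Fin 3)) = sn • (a : EuclideanSpace ℝ (Fin 3)) - cs • (m : EuclideanSpace ℝ (Fin 3))) :
    h ∈ polar R := by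
  by_contra hh
  have ham : ⟪a, m⟫ = 0 := by
    rw [em, inner_add_right, real_inner_smul_right, real_inner_smul_right, ham₁, ham₂]; ring
  have hma : ⟪m, a⟫ = 0 := by rw [real_inner_comm]; exact ham
  have hha : ⟪h, a⟫ = sn := by
    rw [eh, inner_sub_left, real_inner_smul_left, real_inner_smul_left, inner_self_coe, hma]; ring
  have hhm : ∀ x : S2, ⟪a, x⟫ = 0 → ⟪h, x⟫ = -cs * ⟪m, x⟫ := by
    intro x hx
    rw [eh, inner_sub_left, real_inner_smul_left, real_inner_smul_left, hx]; ring
  set Z := R ∩ hemisphere h with hZ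
  have hZb : IsConvexBody Z := isConvexBody_inter_hemisphere hR.1 ha (hha ▸ hsn)
  have hZR : Z ≠ R := fun e => hh fun x hx => mem_hemisphere.1 ((e ▸ hx : x ∈ Z).2)
  have hlt := hR.2 Z hZb Set.inter_subset_left hZR
  have hpol : polar R ⊆ polar Z := fun k hk x hx => hk x hx.1
  obtain ⟨k₀, hk₀, k₀', hk₀', hd⟩ := exists_of_thickness_lt hZb hne (hpol hm₁) (hpol hm₂) hlt
  have haZ : a ∈ Z := ⟨ha, mem_hemisphere.2 (by rw [hha]; exact hsn.le)⟩
  have hbZ : ∀ b m' : S2, b ∈ R → ⟪a, m'⟫ = 0 →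
      (b : EuclideanSpace ℝ (Fin 3)) = cs • (a : EuclideanSpace ℝ (Fin 3)) + sn • (m' : EuclideanSpace ℝ (Fin 3)) →
      b ∈ Z := by
    intro b m' hb hm' e
    refine ⟨hb, mem_hemisphere.2 ?_⟩
    rw [e, inner_add_right, real_inner_smul_right, real_inner_smul_right, hha, hhm m' hm']
    -- The value is sn · cs · (1 − ⟨m, m'⟩): b₁ and b₂ survive the cut.
    nlinarith [mul_nonneg (mul_nonneg hsn.le hcs.le) (sub_nonneg.2 (inner_le_one m m'))]
  have hb₁Z := hbZ b₁ m₁ hb₁ ham₁ eb₁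
  have hb₂Z := hbZ b₂ m₂ hb₂ ham₂ eb₂
  obtain ⟨k, hk, k', hk', hmin⟩ := exists_min_pair hk₀
  have hlow : ⟪k, k'⟫ < -cs := by
    refine (hmin k₀ hk₀ k₀' hk₀').trans_lt ?_
    rw [← cos_sdist, hcos, ← Real.cos_pi_sub]
    refine Real.cos_lt_cos_of_nonneg_of_le_pi (by linarith) ?_ (by linarith)
    exact InnerProductGeometry.angle_le_pi _ _
  -- Stated for an arbitrary ordered pair so that it applies to (k, k') and to (k', k).
  have hmain : ∀ k ∈ polar Z, ∀ k' ∈ polar Z, ⟪k, k'⟫ < -cs →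
      (∀ l ∈ polar Z, ∀ l' ∈ polar Z, ⟪k, k'⟫ ≤ ⟪l, l'⟫) → k' ∈ polar R := by
    clear hk hk' hlow hmin k k'
    intro k hk k' hk' hlow hmin
    by_contra hkR
    have hl : IsLune k k' := by
      refine isLune_of_mem_polar hZb hk hk' ?_
      rintro rfl
      rw [inner_self_coe] at hlow
      linarith
    have hc := real_inner_comm (k : EuclideanSpace ℝ (Fin 3)) (k' : EuclideanSpace ℝ (Fin 3))
    obtain ⟨p, hp⟩ := exists_center hl.symm
    obtain ⟨q, hq⟩ := exists_center hl
    have hp' := (isSemicircleCenter_iff hl.symm).2 hp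
    have hq' := (isSemicircleCenter_iff hl).2 hq
    have hpZ : p ∈ Z :=
      semicircleCenter_mem hZb hl.symm hk' (fun l hl' => hmin k hk l hl') hp'
    have hqZ : q ∈ Z := by
      refine semicircleCenter_mem hZb hl hk (fun l hl' => ?_) hq'
      rw [hc, real_inner_comm (l : EuclideanSpace ℝ (Fin 3)) (k' : EuclideanSpace ℝ (Fin 3))]
      exact hmin l hl' k' hk'
    have hkp : ⟪k', p⟫ = 0 := mem_greatCircle.1 hp'.1
    have hhp := inner_eq_zero_of_notMem_polar hR.1 hk' hkR hpZ hkp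
    rw [hc] at hp
    have hm₁p := hm₁ p hpZ.1
    have hm₂p := hm₂ p hpZ.1
    have hn₁p := hn₁ p hpZ.1
    have hn₂p := hn₂ p hpZ.1
    rw [en₁, inner_sub_left, real_inner_smul_left, real_inner_smul_left] at hn₁p
    rw [en₂, inner_sub_left, real_inner_smul_left, real_inner_smul_left] at hn₂p
    have hmp : ⟪m, p⟫ = s * ⟪m₁, p⟫ + t * ⟪m₂, p⟫ := by
      rw [em, inner_add_left, real_inner_smul_left, real_inner_smul_left]
    have hhp' : sn * ⟪a, p⟫ = cs * ⟪m, p⟫ := by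
      rw [eh, inner_sub_left, real_inner_smul_left, real_inner_smul_left] at hhp
      linarith
    have hl₁₂ := isLune_of_mem_polar hR.1 hm₁ hm₂ hne
    have hap : 0 < ⟪a, p⟫ := by
      have h0 : 0 ≤ ⟪m, p⟫ := by rw [hmp]; positivity
      have h1 : 0 ≤ ⟪a, p⟫ := nonneg_of_mul_nonneg_right (hhp' ▸ mul_nonneg hcs.le h0) hsn
      refine lt_of_le_of_ne h1 fun e => ?_
      rw [← e] at hn₁p hn₂p
      have e1 : ⟪m₁, p⟫ = 0 :=
        le_antisymm (nonpos_of_mul_nonpos_right (by linarith) hcs) hm₁p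
      have e2 : ⟪m₂, p⟫ = 0 :=
        le_antisymm (nonpos_of_mul_nonpos_right (by linarith) hcs) hm₂p
      obtain ⟨x, y, z, ep⟩ := exists_coordinates ham₁ ham₂ hl₁₂.one_sub_sq_pos p
      have := inner_self_coe p
      nth_rw 1 [ep] at this
      rw [inner_add_left, inner_add_left, real_inner_smul_left, real_inner_smul_left,
        real_inner_smul_left, ← e, e1, e2] at this
      norm_num at this
    have hst : s ^ 2 + t ^ 2 + 2 * s * t * ⟪m₁, m₂⟫ = 1 := by
      have := inner_self_coe m
      rw [em] at this
      simp only [inner_add_left, inner_add_right, real_inner_smul_left, real_inner_smul_right,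
        inner_self_coe, real_inner_comm (m₁ : EuclideanSpace ℝ (Fin 3)) (m₂ : EuclideanSpace ℝ (Fin 3))] at this
      linarith
    have hka := hk' a haZ
    have hkb₁ := hk' b₁ hb₁Z
    have hkb₂ := hk' b₂ hb₂Z
    rw [eb₁, inner_add_right, real_inner_smul_right, real_inner_smul_right] at hkb₁
    rw [eb₂, inner_add_right, real_inner_smul_right, real_inner_smul_right] at hkb₂
    obtain ⟨α, β, hα, hβ, e⟩ := exists_nonneg_coordinates hsn hcs ham₁ ham₂
      (sub_pos.1 hl₁₂.one_sub_sq_pos) hs ht hst (hmp ▸ hhp') hm₁p hm₂p hap (by linarith)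
      (by linarith) hkp hka hkb₁ hkb₂
    have hfin := neg_inner_le_inner_of_centers (Real.sqrt_pos.2 hl.one_sub_sq_pos)
      (Real.sq_sqrt hl.one_sub_sq_pos.le) (by linarith) hp hq hkp hap (hk a haZ) (by
        rw [e, inner_add_left, real_inner_smul_left, real_inner_smul_left]
        exact add_nonneg (mul_nonneg hα (hm₁ q hqZ.1)) (mul_nonneg hβ (hm₂ q hqZ.1)))
    have hB := inner_sq_add_inner_sq_le_one ham p
    -- The point p lies on a great circle tangent to the circle of radius Δ about a, hence no closer
    -- to a than Δ.
    have hle : ⟪a, p⟫ ≤ cs := by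
      have h1 : cs ^ 2 * ⟪a, p⟫ ^ 2 + (sn * ⟪a, p⟫) ^ 2 ≤ cs ^ 2 := by
        rw [hhp']; nlinarith [sq_nonneg cs]
      have h2 : ⟪a, p⟫ ^ 2 ≤ cs ^ 2 := by
        calc ⟪a, p⟫ ^ 2 = cs ^ 2 * ⟪a, p⟫ ^ 2 + (sn * ⟪a, p⟫) ^ 2 := by
              linear_combination -⟪a, p⟫ ^ 2 * hsc
          _ ≤ _ := h1
      exact abs_le_of_sq_le_sq' h2 hcs.le |>.2
    linarith
  have hkR' := hmain k hk k' hk' hlow hmin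
  have hkR := hmain k' hk' k hk (by rw [real_inner_comm]; exact hlow) (fun l hl l' hl' => by
    rw [real_inner_comm]; exact hmin l hl l' hl')
  have := neg_cos_thickness_le_inner hR.1 hkR hkR'
  rw [← hcos] at this
  linarith

/-! ### Lunes of thickness Δ around R -/

lemma sqrt_one_sub_cos_sq {x : ℝ} (hx : 0 ≤ Real.sin x) : √(1 - (-Real.cos x) ^ 2) = Real.sin x := by
  rw [neg_sq, ← Real.sin_sq, Real.sqrt_sq hx]

/-- The lune cut by a hemisphere `K` of minimum width and by `K^*`. -/
lemma minimal_lune {R : Set S2} (hR : IsConvexBody R) {m m' a b : S2} (hm : m ∈ polar R)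
    (hst : IsStar R m m') (hw : width R m = thickness R) (ha : IsSemicircleCenter m m' a)
    (hb : IsSemicircleCenter m' m b) :
    0 < Real.sin (thickness R) ∧ m' ∈ polar R ∧ a ∈ R ∧ b ∈ R ∧ ⟪a, m⟫ = 0 ∧
    (m' : EuclideanSpace ℝ (Fin 3)) = Real.sin (thickness R) • (a : EuclideanSpace ℝ (Fin 3))
      - Real.cos (thickness R) • (m : EuclideanSpace ℝ (Fin 3)) ∧
    (b : EuclideanSpace ℝ (Fin 3)) = Real.cos (thickness R) • (a : EuclideanSpace ℝ (Fin 3))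
      + Real.sin (thickness R) • (m : EuclideanSpace ℝ (Fin 3)) := by
  have hl := hst.isLune
  have hm' := hst.1.mem_polar
  have hδ : thickness R = π - sdist m m' := by rw [← hw, hst.width_eq]
  have hin : ⟪m, m'⟫ = -Real.cos (thickness R) := by
    rw [hδ, Real.cos_pi_sub, neg_neg, cos_sdist]
  have hin' : ⟪m', m⟫ = -Real.cos (thickness R) := by rw [real_inner_comm, hin]
  have hsn0 : 0 ≤ Real.sin (thickness R) := by
    rw [hδ, Real.sin_pi_sub]
    exact Real.sin_nonneg_of_nonneg_of_le_pi (InnerProductGeometry.angle_nonneg _ _)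
      (InnerProductGeometry.angle_le_pi _ _)
  have hsn : 0 < Real.sin (thickness R) := by
    have := Real.sqrt_pos.2 hl.one_sub_sq_pos
    rwa [hin, sqrt_one_sub_cos_sq hsn0] at this
  have ea := (isSemicircleCenter_iff hl).1 ha
  have eb := (isSemicircleCenter_iff hl.symm).1 hb
  rw [hin, sqrt_one_sub_cos_sq hsn0] at ea
  rw [hin', sqrt_one_sub_cos_sq hsn0] at eb
  have em' : (m' : EuclideanSpace ℝ (Fin 3)) = Real.sin (thickness R) • (a : EuclideanSpace ℝ (Fin 3))
      - Real.cos (thickness R) • (m : EuclideanSpace ℝ (Fin 3)) := by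
    rw [ea]; module
  refine ⟨hsn, hm', ?_, ?_, ?_, em', ?_⟩
  · refine semicircleCenter_mem hR hl hm (fun l hl' => ?_) ha
    rw [hin']
    exact neg_cos_thickness_le_inner hR hm' hl'
  · refine semicircleCenter_mem hR hl.symm hm' (fun l hl' => ?_) hb
    rw [hin]
    exact neg_cos_thickness_le_inner hR hm hl'
  · rw [real_inner_comm]
    exact mem_greatCircle.1 ha.1
  · apply smul_right_injective _ hsn.ne'
    change Real.sin (thickness R) • (b : EuclideanSpace ℝ (Fin 3)) = Real.sin (thickness R) • _
    rw [eb, em', smul_add, smul_smul (Real.sin (thickness R)) (Real.sin (thickness R)),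
      ← pow_two, Real.sin_sq]
    module

/-- A lune of thickness `Δ(R)` that contains `R`. -/
lemma frontier_and_width_of_mem_polar {R : Set S2} (hR : IsConvexBody R) {a m h : S2}
    (hsn : 0 < Real.sin (thickness R)) (hΔ : thickness R ≤ π) (hm : m ∈ polar R) (hh : h ∈ polar R)
    (ham : ⟪a, m⟫ = 0)
    (eh : (h : EuclideanSpace ℝ (Fin 3)) = Real.sin (thickness R) • (a : EuclideanSpace ℝ (Fin 3))
      - Real.cos (thickness R) • (m : EuclideanSpace ℝ (Fin 3))) :
    (∀ x : S2, (x : EuclideanSpace ℝ (Fin 3)) =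
      Real.cos (thickness R) • (a : EuclideanSpace ℝ (Fin 3))
      + Real.sin (thickness R) • (m : EuclideanSpace ℝ (Fin 3)) → x ∈ frontier R) ∧
    width R m ≤ thickness R := by
  have hin : ⟪h, m⟫ = -Real.cos (thickness R) := by
    rw [eh, inner_sub_left, real_inner_smul_left, real_inner_smul_left, inner_self_coe, ham]; ring
  have hin' : ⟪m, h⟫ = -Real.cos (thickness R) := by rw [real_inner_comm, hin]
  have hne : h ≠ m := by
    rintro rfl
    rw [inner_self_coe] at hin
    nlinarith [Real.sin_sq_add_cos_sq (thickness R)]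
  have hl := isLune_of_mem_polar hR hh hm hne
  -- The value −cos Δ is a lower bound for inner products on `polar R`, so h is farthest from m
  -- there.
  have hmin : ∀ l ∈ polar R, ⟪m, h⟫ ≤ ⟪m, l⟫ := fun l hl' => by
    rw [hin']
    exact neg_cos_thickness_le_inner hR hm hl'
  constructor
  · intro x ex
    have hx : IsSemicircleCenter h m x := by
      rw [isSemicircleCenter_iff hl, hin, sqrt_one_sub_cos_sq hsn.le, ex, eh, smul_add,
        smul_smul (Real.sin (thickness R)) (Real.sin (thickness R)), ← pow_two, Real.sin_sq]
      module
    exact mem_frontier_of_inner_eq_zero hh (semicircleCenter_mem hR hl hh hmin hx)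
      (mem_greatCircle.1 hx.1)
  · have := width_le hl.symm (supports_of_isMin hR hl hh hmin)
    rwa [sdist_eq_arccos, hin', Real.arccos_neg, Real.arccos_cos (thickness_nonneg R) hΔ,
      sub_sub_cancel] at this

/-! ### The order ⪯ around a common support point -/

lemma inner_rotation_axis (a m : S2) (ham : ⟪a, m⟫ = 0) :
    ⟪m, WithLp.toLp 2 (crossProduct (WithLp.ofLp (a : EuclideanSpace ℝ (Fin 3)))
      (WithLp.ofLp (m : EuclideanSpace ℝ (Fin 3))))⟫ = 0 ∧
    ⟪WithLp.toLp 2 (crossProduct (WithLp.ofLp (a : EuclideanSpace ℝ (Fin 3)))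
      (WithLp.ofLp (m : EuclideanSpace ℝ (Fin 3)))),
      WithLp.toLp 2 (crossProduct (WithLp.ofLp (a : EuclideanSpace ℝ (Fin 3)))
      (WithLp.ofLp (m : EuclideanSpace ℝ (Fin 3))))⟫ = 1 := by
  have h1 := inner_self_coe a
  have h2 := inner_self_coe m
  simp only [PiLp.inner_apply, Fin.sum_univ_three, crossProduct, LinearMap.mk₂_apply,
    RCLike.inner_apply, conj_trivial, Matrix.cons_val_zero, Matrix.cons_val_one,
    Matrix.cons_val] at h1 h2 ham ⊢
  constructor
  · ring
  · generalize (a : EuclideanSpace ℝ (Fin 3)) = u at *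
    generalize (m : EuclideanSpace ℝ (Fin 3)) = v at *
    -- Lagrange's identity |a × m|² = |a|²|m|² − ⟨a, m⟩².
    linear_combination (v 0 * v 0 + v 1 * v 1 + v 2 * v 2) * h1 + h2 -
      (v 0 * u 0 + v 1 * u 1 + v 2 * u 2) * ham

/-- For hemispheres supporting at a common point `a`, the relation `⪯` is the cyclic order of
their centers around `a`. -/
lemma exists_rotate_of_preceq {R : Set S2} (hR : IsConvexBody R) {a x y z : S2} (ha : a ∈ R)
    (hax : ⟪a, x⟫ = 0) (hay : ⟪a, y⟫ = 0) (haz : ⟪a, z⟫ = 0) (hxy : x ≠ y) (hyz : y ≠ z)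
    (hxz : IsLune x z) (h : Preceq R x y z) :
    ∃ s t : ℝ, 0 < s ∧ s < t ∧ t < 2 * π ∧
      (y : EuclideanSpace ℝ (Fin 3)) = rotate a x s ∧
      (z : EuclideanSpace ℝ (Fin 3)) = rotate a x t := by
  have hcirc : ∀ w : S2, ⟪a, w⟫ = 0 → a ∈ greatCircle w := fun w hw => by
    rw [mem_greatCircle, real_inner_comm, hw]
  rcases h with (⟨h, -⟩ | ⟨c, ⟨⟨hcx, -⟩, hcz⟩, hcR, h⟩) | h | h | h
  · have : a ∈ greatCircle x ∩ greatCircle y ∩ greatCircle z :=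
      ⟨⟨hcirc x hax, hcirc y hay⟩, hcirc z haz⟩
    rw [h] at this
    exact this.elim
  · rw [mem_greatCircle] at hcx hcz
    obtain ⟨r, s, t, e⟩ := exists_coordinates hax haz hxz.one_sub_sq_pos c
    have e1 : r * ⟪a, c⟫ = 1 := by
      have := inner_self_coe c
      nth_rw 1 [e] at this
      rw [inner_add_left, inner_add_left, real_inner_smul_left, real_inner_smul_left,
        real_inner_smul_left, hcx, hcz] at this
      linarith
    have e2 : ⟪a, c⟫ = r := by
      rw [e, inner_add_right, inner_add_right, real_inner_smul_right, real_inner_smul_right,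
        real_inner_smul_right, hax, haz, inner_self_coe]
      ring
    -- The point c is orthogonal to x and z, so c = ±a; the sign is + because R contains no
    -- antipodes.
    have hca : a = c := by
      rw [e2] at e1
      rcases mul_self_eq_one_iff.1 e1 with hr | hr
      · rw [← inner_eq_one_iff, e2, hr]
      · have : a = -c := by rw [← inner_eq_neg_one_iff, e2, hr]
        exact absurd (this ▸ ha) (hR.convex.1 c hcR)
    rw [hca]
    exact h
  · exact absurd h hxy
  · exact absurd h hyz
  · exact absurd h.symm hxz.1

/-- The centers of the hemispheres supporting `R` at `a` lie on the shorter arc connecting the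
extreme ones. -/
lemma exists_combination_of_preceq {R : Set S2} (hR : IsConvexBody R) {a m₁ m₂ m : S2}
    (ha : a ∈ R) (hm₁ : m₁ ∈ polar R) (hm₂ : m₂ ∈ polar R) (ham₁ : ⟪a, m₁⟫ = 0)
    (ham₂ : ⟪a, m₂⟫ = 0) (hne : m₁ ≠ m₂)
    (hbetween : ∀ m, SupportsAt m R a → Preceq R m₁ m m₂) (hm : SupportsAt m R a)
    (h₁ : m₁ ≠ m) (h₂ : m ≠ m₂) :
    ∃ s t : ℝ, 0 < s ∧ 0 < t ∧ (m : EuclideanSpace ℝ (Fin 3)) =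
      s • (m₁ : EuclideanSpace ℝ (Fin 3)) + t • (m₂ : EuclideanSpace ℝ (Fin 3)) := by
  have hl := isLune_of_mem_polar hR hm₁ hm₂ hne
  obtain ⟨hJ1, hJ2⟩ := inner_rotation_axis a m₁ ham₁
  have key : ∀ n, SupportsAt n R a → m₁ ≠ n → n ≠ m₂ → ∃ s t : ℝ, 0 < s ∧ s < t ∧ t < 2 * π ∧
      (n : EuclideanSpace ℝ (Fin 3)) = rotate a m₁ s ∧
      (m₂ : EuclideanSpace ℝ (Fin 3)) = rotate a m₁ t := by
    intro n hn hn₁ hn₂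
    refine exists_rotate_of_preceq hR ha ham₁ ?_ ham₂ hn₁ hn₂ hl (hbetween n hn)
    rw [real_inner_comm]
    exact ((supportsAt_iff hR.closed).1 hn).2.2
  unfold rotate at key
  set J := WithLp.toLp 2 (crossProduct (WithLp.ofLp (a : EuclideanSpace ℝ (Fin 3)))
      (WithLp.ofLp (m₁ : EuclideanSpace ℝ (Fin 3))))
  have hJ1' : ⟪J, m₁⟫ = 0 := by rw [real_inner_comm]; exact hJ1
  obtain ⟨s, t, hs, hst, ht, es, et⟩ := key m hm h₁ h₂
  have hin : ⟪m₁, m₂⟫ = Real.cos t := by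
    rw [et, inner_add_right, real_inner_smul_right, real_inner_smul_right, inner_self_coe, hJ1]
    ring
  have hsq : Real.sin t ^ 2 = 1 - ⟪m₁, m₂⟫ ^ 2 := by rw [hin, Real.sin_sq]
  -- Otherwise the rotation from m₁ to m₂ takes the long way round. The midpoint n of the short arc
  -- also supports R at a, yet is not met on that way: being halfway forces s' > π, while sin(t' −
  -- s') has the sign of sin t', which is negative, although 0 < t' − s' < π.
  have hsin : 0 < Real.sin t := by
    by_contra hneg
    have hneg' : Real.sin t < 0 := by
      refine lt_of_le_of_ne (not_lt.1 hneg) fun e => ?_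
      have := hl.one_sub_sq_pos
      rw [← hsq, e] at this
      norm_num at this
    have hv : (m₁ : EuclideanSpace ℝ (Fin 3)) + m₂ ≠ 0 := by
      intro e
      exact hl.2 (Subtype.ext (by rw [coe_neg_sphere]; exact eq_neg_of_add_eq_zero_left e))
    obtain ⟨n, en⟩ := exists_sphere_smul hv
    have hN : 0 < ‖(m₁ : EuclideanSpace ℝ (Fin 3)) + m₂‖ := norm_pos_iff.2 hv
    set N := ‖(m₁ : EuclideanSpace ℝ (Fin 3)) + m₂‖
    have hni : ∀ x : EuclideanSpace ℝ (Fin 3), N * ⟪n, x⟫ = ⟪m₁, x⟫ + ⟪m₂, x⟫ := by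
      intro x
      rw [← real_inner_smul_left, ← en, inner_add_left]
    have hc := hl.one_sub_sq_pos
    have hnJ : N * ⟪n, J⟫ = Real.sin t := by
      rw [hni, hJ1, et, inner_add_left, real_inner_smul_left, real_inner_smul_left, hJ1, hJ2]
      ring
    have hn : SupportsAt n R a := by
      refine (supportsAt_iff hR.closed).2 ⟨fun x hx => ?_, ha, ?_⟩
      · refine nonneg_of_mul_nonneg_right ?_ hN
        rw [hni]
        exact add_nonneg (hm₁ x hx) (hm₂ x hx)
      · have := hni a
        rw [real_inner_comm (a : EuclideanSpace ℝ (Fin 3)) (m₁ : EuclideanSpace ℝ (Fin 3)), ham₁,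
          real_inner_comm (a : EuclideanSpace ℝ (Fin 3)) (m₂ : EuclideanSpace ℝ (Fin 3)), ham₂,
          add_zero] at this
        exact (mul_eq_zero.1 this).resolve_left hN.ne'
    have hn1 : m₁ ≠ n := by
      rintro rfl
      rw [hJ1, mul_zero] at hnJ
      exact hneg'.ne hnJ.symm
    have hn2 : n ≠ m₂ := by
      rintro rfl
      have e1 := hni m₁
      have e2 := hni n
      rw [inner_self_coe, real_inner_comm] at e1
      rw [inner_self_coe] at e2
      nlinarith
    obtain ⟨s', t', hs', hst', ht', es', et'⟩ := key n hn hn1 hn2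
    have c1 : Real.sin t' = Real.sin t := by
      have := congrArg (fun v => ⟪J, v⟫) (et.symm.trans et')
      simp only [inner_add_right, real_inner_smul_right, hJ1', hJ2] at this
      linarith
    have c2 : N * Real.sin s' = Real.sin t' := by
      rw [c1, ← hnJ, es', inner_add_left, real_inner_smul_left, real_inner_smul_left, hJ1, hJ2]
      ring
    have c3 : N * Real.cos s' = 1 + Real.cos t' := by
      have := hni m₁
      rw [es', et', inner_add_left, real_inner_smul_left, real_inner_smul_left, inner_self_coe,
        hJ1', inner_add_left, real_inner_smul_left, real_inner_smul_left, inner_self_coe,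
        hJ1'] at this
      linarith
    have c4 : N * Real.sin (t' - s') = Real.sin t' := by
      rw [Real.sin_sub]
      linear_combination Real.sin t' * c3 - Real.cos t' * c2
    have c5 : π < s' := by
      by_contra hle
      have := Real.sin_nonneg_of_nonneg_of_le_pi hs'.le (not_lt.1 hle)
      have := mul_nonneg hN.le this
      linarith
    have c6 := Real.sin_pos_of_pos_of_lt_pi (sub_pos.2 hst') (by linarith)
    have := mul_pos hN c6
    linarith
  have htπ : t < π := by
    by_contra hle
    have := Real.sin_nonpos_of_nonpos_of_neg_pi_le (x := t - 2 * π) (by linarith) (by linarith)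
    rw [Real.sin_sub_two_pi] at this
    linarith
  -- The coefficients of spherical linear interpolation.
  refine ⟨Real.sin (t - s) / Real.sin t, Real.sin s / Real.sin t,
    div_pos (Real.sin_pos_of_pos_of_lt_pi (by linarith) (by linarith)) hsin,
    div_pos (Real.sin_pos_of_pos_of_lt_pi (by linarith) (by linarith)) hsin, ?_⟩
  rw [es, et, smul_add, smul_smul, smul_smul, div_mul_cancel₀ _ hsin.ne', ← add_assoc, ← add_smul]
  congr 2
  rw [Real.sin_sub]
  field_simp
  ring

/-! ### The circle piece and the widths -/

lemma circlePiece_subset_frontier_and_width_eq (R : Set S2) (hR : IsReduced R)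
    (hΔ : thickness R < π / 2)
    (m₁ m₂ m₁' m₂' a₁ a₂ b₁ b₂ : S2)
    (hne : m₁ ≠ m₂)
    (hs₁ : Supports m₁ R) (hs₂ : Supports m₂ R)
    (hw₁ : width R m₁ = thickness R)
    (hw₂ : width R m₂ = thickness R)
    (hm₁' : IsStar R m₁ m₁') (hm₂' : IsStar R m₂ m₂')
    (ha₁ : IsSemicircleCenter m₁ m₁' a₁)
    (ha₂ : IsSemicircleCenter m₂ m₂' a₂)
    (hb₁ : IsSemicircleCenter m₁' m₁ b₁)
    (hb₂ : IsSemicircleCenter m₂' m₂ b₂)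
    (ha : a₁ = a₂)
    (hbetween : ∀ m, SupportsAt m R a₁ → Preceq R m₁ m m₂) :
    circlePiece a₁ (thickness R) b₁ b₂ ⊆ frontier R ∧
      ∀ m, SupportsAt m R a₁ →
        width R m = thickness R := by
  subst ha
  have hC := hR.1
  have hp₁ := hs₁.mem_polar
  have hp₂ := hs₂.mem_polar
  have hΔπ : thickness R ≤ π := by linarith [Real.pi_pos]
  obtain ⟨hsn, hn₁, haR, hbR₁, ham₁, en₁, eb₁⟩ := minimal_lune hC hp₁ hm₁' hw₁ ha₁ hb₁
  obtain ⟨-, hn₂, -, hbR₂, ham₂, en₂, eb₂⟩ := minimal_lune hC hp₂ hm₂' hw₂ ha₂ hb₂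
  have hcs : 0 < Real.cos (thickness R) :=
    Real.cos_pos_of_mem_Ioo ⟨by linarith [Real.pi_pos, thickness_nonneg R], hΔ⟩
  have main : ∀ (m : S2) (s t : ℝ), 0 < s → 0 < t →
      (m : EuclideanSpace ℝ (Fin 3)) = s • (m₁ : EuclideanSpace ℝ (Fin 3))
        + t • (m₂ : EuclideanSpace ℝ (Fin 3)) →
      (∀ x : S2, (x : EuclideanSpace ℝ (Fin 3)) =
        Real.cos (thickness R) • (a₁ : EuclideanSpace ℝ (Fin 3))
        + Real.sin (thickness R) • (m : EuclideanSpace ℝ (Fin 3)) → x ∈ frontier R) ∧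
      width R m ≤ thickness R := by
    intro m s t hs ht em
    have ham : inner ℝ (a₁ : EuclideanSpace ℝ (Fin 3)) (m : EuclideanSpace ℝ (Fin 3)) = 0 := by
      rw [em, inner_add_right, real_inner_smul_right, real_inner_smul_right, ham₁, ham₂]; ring
    have hm : m ∈ polar R := by
      intro x hx
      rw [em, inner_add_left, real_inner_smul_left, real_inner_smul_left]
      exact add_nonneg (mul_nonneg hs.le (hp₁ x hx)) (mul_nonneg ht.le (hp₂ x hx))
    have hnorm : ‖Real.sin (thickness R) • (a₁ : EuclideanSpace ℝ (Fin 3))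
        - Real.cos (thickness R) • (m : EuclideanSpace ℝ (Fin 3))‖ = 1 := by
      rw [← sq_eq_sq₀ (norm_nonneg _) zero_le_one, norm_sub_sq_real, norm_smul, norm_smul,
        real_inner_smul_left, real_inner_smul_right, ham, norm_coe, norm_coe, Real.norm_eq_abs,
        Real.norm_eq_abs, mul_one, mul_one, sq_abs, sq_abs]
      linarith [Real.sin_sq_add_cos_sq (thickness R)]
    let h : S2 := ⟨_, mem_sphere_zero_iff_norm.2 hnorm⟩
    have hh : h ∈ polar R :=
      mem_polar_of_isReduced hR hsn hcs (Real.sin_sq_add_cos_sq _) rfl hΔπ hp₁ hp₂ hn₁ hn₂ haR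
        hbR₁ hbR₂ hne ham₁ ham₂ en₁ en₂ eb₁ eb₂ hs ht em rfl
    exact frontier_and_width_of_mem_polar hC hsn hΔπ hm hh ham rfl
  constructor
  · rintro x ⟨hd, r, s, t, hs, ht, e⟩
    have hax : inner ℝ (a₁ : EuclideanSpace ℝ (Fin 3)) (x : EuclideanSpace ℝ (Fin 3))
        = Real.cos (thickness R) := by rw [← hd, cos_sdist]
    have hr : r + s * Real.cos (thickness R) + t * Real.cos (thickness R)
        = Real.cos (thickness R) := by
      rw [e, eb₁, eb₂] at hax
      simp only [inner_add_right, real_inner_smul_right, inner_self_coe, ham₁, ham₂] at hax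
      linarith
    -- The distance condition fixes r, so x is the semicircle center belonging to m = s m₁ + t m₂,
    -- which has norm 1 because x does.
    have ex : (x : EuclideanSpace ℝ (Fin 3)) =
        Real.cos (thickness R) • (a₁ : EuclideanSpace ℝ (Fin 3)) + Real.sin (thickness R) •
          (s • (m₁ : EuclideanSpace ℝ (Fin 3)) + t • (m₂ : EuclideanSpace ℝ (Fin 3))) := by
      rw [e, eb₁, eb₂]
      nth_rw 3 [← hr]
      module
    have hnorm : ‖s • (m₁ : EuclideanSpace ℝ (Fin 3)) + t • (m₂ : EuclideanSpace ℝ (Fin 3))‖ = 1 := by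
      have h1 := norm_coe x
      rw [ex, ← sq_eq_sq₀ (norm_nonneg _) zero_le_one, norm_add_sq_real, norm_smul, norm_smul,
        norm_coe, real_inner_smul_left, real_inner_smul_right, inner_add_right,
        real_inner_smul_right, real_inner_smul_right, ham₁, ham₂, mul_pow, mul_pow,
        Real.norm_eq_abs, Real.norm_eq_abs, sq_abs, sq_abs] at h1
      rw [← sq_eq_sq₀ (norm_nonneg _) zero_le_one]
      apply mul_left_cancel₀ (pow_pos hsn 2).ne'
      linarith [Real.sin_sq_add_cos_sq (thickness R)]
    -- For s = 0 or t = 0 the point is b₂ or b₁, and the given lune replaces the cutting argument,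
    -- which needs positive coefficients.
    rcases hs.eq_or_lt with rfl | hs
    · rw [zero_smul, zero_add, norm_smul, norm_coe, mul_one, Real.norm_of_nonneg ht] at hnorm
      rw [hnorm, zero_smul, zero_add, one_smul, ← eb₂] at ex
      rw [Subtype.ext ex]
      exact (frontier_and_width_of_mem_polar hC hsn hΔπ hp₂ hn₂ ham₂ en₂).1 b₂ eb₂
    rcases ht.eq_or_lt with rfl | ht
    · rw [zero_smul, add_zero, norm_smul, norm_coe, mul_one, Real.norm_of_nonneg hs.le] at hnorm
      rw [hnorm, zero_smul, add_zero, one_smul, ← eb₁] at ex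
      rw [Subtype.ext ex]
      exact (frontier_and_width_of_mem_polar hC hsn hΔπ hp₁ hn₁ ham₁ en₁).1 b₁ eb₁
    exact (main ⟨_, mem_sphere_zero_iff_norm.2 hnorm⟩ s t hs ht rfl).1 x ex
  · intro m hm
    refine le_antisymm ?_ (thickness_le_width ⟨a₁, hm⟩)
    by_cases h₁ : m₁ = m
    · rw [← h₁, hw₁]
    by_cases h₂ : m = m₂
    · rw [h₂, hw₂]
    obtain ⟨s, t, hs, ht, em⟩ :=
      exists_combination_of_preceq hC haR hp₁ hp₂ ham₁ ham₂ hne hbetween hm h₁ h₂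
    exact (main m s t hs ht em).2

end SphericalReduced

theorem proposition1 (R : Set SphericalReduced.S2) (hR : SphericalReduced.IsReduced R)
    (hΔ : SphericalReduced.thickness R < π / 2)
    (m₁ m₂ m₁' m₂' a₁ a₂ b₁ b₂ : SphericalReduced.S2)
    (hne : m₁ ≠ m₂)
    (hs₁ : SphericalReduced.Supports m₁ R) (hs₂ : SphericalReduced.Supports m₂ R)
    (hw₁ : SphericalReduced.width R m₁ = SphericalReduced.thickness R)
    (hw₂ : SphericalReduced.width R m₂ = SphericalReduced.thickness R)
    (hm₁' : SphericalReduced.IsStar R m₁ m₁') (hm₂' : SphericalReduced.IsStar R m₂ m₂')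
    (ha₁ : SphericalReduced.IsSemicircleCenter m₁ m₁' a₁)
    (ha₂ : SphericalReduced.IsSemicircleCenter m₂ m₂' a₂)
    (hb₁ : SphericalReduced.IsSemicircleCenter m₁' m₁ b₁)
    (hb₂ : SphericalReduced.IsSemicircleCenter m₂' m₂ b₂)
    (ha : a₁ = a₂)
    (hbetween : ∀ m, SphericalReduced.SupportsAt m R a₁ → SphericalReduced.Preceq R m₁ m m₂) :
    SphericalReduced.circlePiece a₁ (SphericalReduced.thickness R) b₁ b₂ ⊆ frontier R ∧
      ∀ m, SphericalReduced.SupportsAt m R a₁ →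
        SphericalReduced.width R m = SphericalReduced.thickness R := by
  exact SphericalReduced.circlePiece_subset_frontier_and_width_eq R hR hΔ m₁ m₂ m₁' m₂' a₁ a₂ b₁ b₂ hne
    hs₁ hs₂ hw₁ hw₂ hm₁' hm₂' ha₁ ha₂ hb₁ hb₂ ha hbetween
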